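/- Let $B$ be a simplicial $3$-ball, that is, a finite (abstract) simplicial complex whose geometric realization is homeomorphic to the closed unit ball of $\mathbb{R}^3$. Suppose that $B$ admits a convex linear embedding in $\mathbb{R}^3$, that is, its vertices can be mapped injectively to points of $\mathbb{R}^3$ so that the images of the faces of $B$ are the vertex sets of the simplices of a geometric simplicial complex in $\mathbb{R}^3$ whose underlying space is a convex set. Then $B$ is non-evasive and collapsible. Here non-evasiveness is defined recursively: a single point is non-evasive, and a complex $K$ of positive dimension is non-evasive if it has a vertex $v$ such that both the link $\{s \ne \emptyset : v \notin s,\ s \cup \{v\} \in K\}$ and the deletion $K - v = \{s \in K : v \notin s\}$ are non-evasive; no other complex is non-evasive (faces are nonempty by convention). A face $\sigma$ of $K$ is free if it is properly contained in exactly one other face of $K$; the complex $K$ is collapsible if it can be reduced to a single vertex by finitely many steps, each of which deletes a free face $\sigma$ together with the unique face properly containing it. -/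

import Mathlib

namespace PreAbstractSimplicialComplex

/-- The geometric realization of an abstract simplicial complex, in barycentric coordinates:
nonnegative weights on the vertices that are supported on some face and sum to `1`.  It carries
the product topology, which is the usual topology of `|K|` when `K` is finite. -/
def realization {V : Type*} (K : PreAbstractSimplicialComplex V) : Set (V → ℝ) :=
  {x | (∀ v, 0 ≤ x v) ∧ ∃ s ∈ K.faces, (∀ v, v ∉ s → x v = 0) ∧ ∑ v ∈ s, x v = 1}

/-- `K` is a simplicial `d`-ball: a finite simplicial complex whose geometric realization is
homeomorphic to the closed unit ball of `ℝᵈ`. -/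
def IsSimplicialBall {V : Type*} (d : ℕ) (K : PreAbstractSimplicialComplex V) : Prop :=
  K.faces.Finite ∧
    Nonempty (K.realization ≃ₜ Metric.closedBall (0 : EuclideanSpace ℝ (Fin d)) 1)

/-- `f` and `L` form a linear embedding of `K` into the real vector space `E`: the map `f` is
injective on the vertices of `K`, and the images of the faces of `K` are exactly the faces of the
geometric simplicial complex `L` in `E` (affinely independent vertices, any two simplices meeting
in a common face or not at all).  The image of `|K|` is `L.space`. -/
def IsLinearEmbedding {V E : Type*} [AddCommGroup E] [Module ℝ E]
    (K : PreAbstractSimplicialComplex V) (f : V → E) (L : Geometry.SimplicialComplex ℝ E) : Prop :=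
  Set.InjOn f {v | {v} ∈ K.faces} ∧
    ∀ t : Finset E, t ∈ L.faces ↔ ∃ s ∈ K.faces, (t : Set E) = f '' (s : Set V)

/-- `K` admits a linear embedding into `ℝᵏ` whose image is a convex set. -/
def HasConvexLinearEmbedding {V : Type*} (k : ℕ) (K : PreAbstractSimplicialComplex V) : Prop :=
  ∃ (f : V → EuclideanSpace ℝ (Fin k)) (L : Geometry.SimplicialComplex ℝ (EuclideanSpace ℝ (Fin k))),
    K.IsLinearEmbedding f L ∧ Convex ℝ L.space

/-- The deletion `K - σ`: all faces of `K` that do not contain `σ`. -/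
def deletion {V : Type*} (K : PreAbstractSimplicialComplex V) (σ : Finset V) :
    PreAbstractSimplicialComplex V where
  faces := {s | s ∈ K.faces ∧ ¬ σ ⊆ s}
  isRelLowerSet_faces := by
    rintro s ⟨hs, hσ⟩
    exact ⟨(K.isRelLowerSet_faces hs).1, fun t hts ht =>
      ⟨(K.isRelLowerSet_faces hs).2 hts ht, fun h => hσ (h.trans hts)⟩⟩

/-- The link of `v` in `K`: all nonempty `s` with `v ∉ s` such that `s ∪ {v}` is a face of `K`. -/
def link {V : Type*} (K : PreAbstractSimplicialComplex V) (v : V) :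
    PreAbstractSimplicialComplex V where
  faces := {s | s.Nonempty ∧ ∃ h : v ∉ s, s.cons v h ∈ K.faces}
  isRelLowerSet_faces := by
    rintro s ⟨hne, hv, hs⟩
    refine ⟨hne, fun t hts ht => ⟨ht, fun h => hv (hts h), ?_⟩⟩
    exact (K.isRelLowerSet_faces hs).2 (Finset.cons_subset_cons.2 hts) (Finset.cons_nonempty _)

/-- `K` consists of a single vertex. -/
def IsPoint {V : Type*} (K : PreAbstractSimplicialComplex V) : Prop :=
  ∃ v : V, K.faces = {{v}}

/-- Non-evasiveness: a single point is non-evasive, and so is every complex that has a vertex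
whose link and deletion are both non-evasive.  (The empty complex is not non-evasive, so a
`0`-dimensional complex is non-evasive only if it is a point.) -/
inductive NonEvasive {V : Type*} : PreAbstractSimplicialComplex V → Prop
  | point (K : PreAbstractSimplicialComplex V) (hK : K.IsPoint) : NonEvasive K
  | step (K : PreAbstractSimplicialComplex V) (v : V) (hv : {v} ∈ K.faces)
      (hlink : NonEvasive (K.link v)) (hdel : NonEvasive (K.deletion {v})) : NonEvasive K

/-- A free face: a face that is properly contained in exactly one other face. -/
def IsFreeFace {V : Type*} (K : PreAbstractSimplicialComplex V) (σ : Finset V) : Prop :=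
  σ ∈ K.faces ∧ ∃! τ : Finset V, τ ∈ K.faces ∧ σ ⊂ τ

/-- An elementary collapse: `L` is obtained from `K` by deleting a free face (together with the
unique face containing it). -/
def ElementaryCollapse {V : Type*} (K L : PreAbstractSimplicialComplex V) : Prop :=
  ∃ σ : Finset V, K.IsFreeFace σ ∧ L = K.deletion σ

/-- `K` is collapsible: finitely many elementary collapses reduce it to a single vertex. -/
def Collapsible {V : Type*} (K : PreAbstractSimplicialComplex V) : Prop :=
  ∃ P : PreAbstractSimplicialComplex V, Relation.ReflTransGen ElementaryCollapse K P ∧ P.IsPoint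

end PreAbstractSimplicialComplex

open Topology

namespace PreAbstractSimplicialComplex

/-! ### Faces, links and deletions. -/

variable {V : Type*} {K : PreAbstractSimplicialComplex V}

/-! Sweep the convex body by a linear functional f that separates the vertices, and delete the
vertices from the top down. When v is deleted, its link in what remains is the part of the link of v
in B spanned by the vertices below v. So everything reduces to showing that this lower link is
non-evasive (`IsLinearEmbedding.link_lowerPart_nonEvasive`).

The directions from v to its neighbours span a simplicial fan in 3-space. By convexity of the body,
the fan covers every direction from v to a point of the body, in particular the convex hull of the
downward edge vectors. That hull is a compact convex set on which f is negative, and the smallest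
cones through its points relate it to the lower link. A local-to-global argument on the hull shows
that the lower link is connected and that its integral 1-cocycles are coboundaries
(`IsFan.lowerPart_isConnected`, `IsFan.lowerPart_cocyclesExact`).

Central projection to the plane f = -1 draws the lower link in a plane. Planarity enters only
through a generic linear height on that plane: above and below each vertex, the neighbours are
ordered by angle, so each half of its link is a forest (`IsFan.halfLink_isForest`). A connected
complex with exact cocycles and such a height is non-evasive (`IsPlanarHeight.nonEvasive`): some
vertex that does not disconnect the complex has all its neighbours on one side. By Mayer–Vietoris
its link is connected, hence a tree, and its deletion inherits the hypotheses.

Collapsibility follows from non-evasiveness, because a collapse of the link of v lifts to a collapse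
of K onto K - v. -/

theorem face_subset {s t : Finset V} (hs : s ∈ K.faces) (hts : t ⊆ s) (ht : t.Nonempty) :
    t ∈ K.faces :=
  (K.isRelLowerSet_faces hs).2 hts ht

theorem face_nonempty {s : Finset V} (hs : s ∈ K.faces) : s.Nonempty :=
  (K.isRelLowerSet_faces hs).1

theorem vertex_of_mem {s : Finset V} (hs : s ∈ K.faces) {x : V} (hx : x ∈ s) : {x} ∈ K.faces :=
  face_subset hs (by simpa using hx) (by simp)

theorem mem_deletion_singleton {v : V} {s : Finset V} :
    s ∈ (K.deletion {v}).faces ↔ s ∈ K.faces ∧ v ∉ s := by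
  simp [deletion]

theorem erase_mem_link [DecidableEq V] {v x : V} {s : Finset V} (hs : s ∈ K.faces) (hv : v ∈ s)
    (hx : x ∈ s) (hxv : x ≠ v) : s.erase v ∈ (K.link v).faces := by
  refine ⟨⟨x, by simp [hx, hxv]⟩, by simp, ?_⟩
  rwa [Finset.cons_eq_insert, Finset.insert_erase hv]

theorem link_faces_subset {v : V} : (K.link v).faces ⊆ K.faces := fun s hs => by
  obtain ⟨hne, h, hs⟩ := hs
  exact face_subset hs (Finset.subset_cons h) hne

theorem deletion_faces_subset {σ : Finset V} : (K.deletion σ).faces ⊆ K.faces := fun _ hs => hs.1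

theorem deletion_ncard_lt (hfin : K.faces.Finite) {v : V} (hv : {v} ∈ K.faces) :
    (K.deletion {v}).faces.ncard < K.faces.ncard := by
  refine Set.ncard_lt_ncard ⟨deletion_faces_subset, fun h => ?_⟩ hfin
  have := h hv
  simp [mem_deletion_singleton] at this

/-! ### Non-evasive complexes are collapsible -/

theorem link_deletion_cons {v : V} {σ : Finset V} (hσ : v ∉ σ) :
    (K.deletion (σ.cons v hσ)).link v = (K.link v).deletion σ := by
  ext s
  simp only [link, deletion, Set.mem_ofPred_eq]
  constructor
  · rintro ⟨h1, h2, h3, h4⟩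
    exact ⟨⟨h1, h2, h3⟩, fun h => h4 (Finset.cons_subset_cons.2 h)⟩
  · rintro ⟨⟨h1, h2, h3⟩, h4⟩
    exact ⟨h1, h2, h3, fun h => h4 (Finset.cons_subset_cons.1 h)⟩

theorem deletion_cons_deletion {v : V} {σ : Finset V} (hσ : v ∉ σ) :
    (K.deletion (σ.cons v hσ)).deletion {v} = K.deletion {v} := by
  ext s
  simp only [deletion, Set.mem_ofPred_eq, Finset.singleton_subset_iff]
  constructor
  · rintro ⟨⟨h1, h2⟩, h3⟩
    exact ⟨h1, h3⟩
  · rintro ⟨h1, h3⟩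
    exact ⟨⟨h1, fun h => h3 (h (Finset.mem_cons_self _ _))⟩, h3⟩

theorem exists_link_cons {v : V} {τ : Finset V} (hτ : τ ∈ K.faces) (hv : v ∈ τ) {σ : Finset V}
    (h : σ ⊂ τ) (hσ : v ∈ σ) :
    ∃ ρ, ∃ hρ : v ∉ ρ, ρ ∈ (K.link v).faces ∧ τ = ρ.cons v hρ := by
  classical
  obtain ⟨x, hx, hxσ⟩ := Finset.exists_of_ssubset h
  exact ⟨τ.erase v, by simp, erase_mem_link hτ hv hx (by rintro rfl; exact hxσ hσ),
    by rw [Finset.cons_eq_insert, Finset.insert_erase hv]⟩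

theorem IsFreeFace.cons_of_link {v : V} {σ : Finset V} (h : (K.link v).IsFreeFace σ)
    (hσ : v ∉ σ) : K.IsFreeFace (σ.cons v hσ) := by
  obtain ⟨⟨_, _, hK⟩, τ, ⟨⟨hτ1, hτ2, hτ3⟩, hστ⟩, huniq⟩ := h
  refine ⟨hK, τ.cons v hτ2, ⟨hτ3, ?_⟩, ?_⟩
  · exact ⟨Finset.cons_subset_cons.2 hστ.1, fun h => hστ.2 (Finset.cons_subset_cons.1 h)⟩
  · rintro ρ ⟨hρ, hσρ⟩
    obtain ⟨ρ', h1, h2, rfl⟩ := exists_link_cons hρ (hσρ.1 (Finset.mem_cons_self _ _)) hσρ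
      (Finset.mem_cons_self _ _)
    have := huniq ρ' ⟨h2, Finset.cons_subset_cons.1 hσρ.1, fun h => hσρ.2 (Finset.cons_subset_cons.2 h)⟩
    subst this
    rfl

/-- Collapsing the link along a free face σ lifts to collapsing K along σ ∪ {v}, which leaves the
faces without v untouched. When the link has become one vertex u, the face {v} is free in {v, u},
and removing it deletes v. The link is passed as `M` with an equation because K changes along the
chain. -/
theorem collapses_to_deletion {v : V} {M P : PreAbstractSimplicialComplex V}
    (h : Relation.ReflTransGen ElementaryCollapse M P) (hP : P.IsPoint)
    (K : PreAbstractSimplicialComplex V) (hM : M = K.link v) :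
    Relation.ReflTransGen ElementaryCollapse K (K.deletion {v}) := by
  induction h using Relation.ReflTransGen.head_induction_on generalizing K with
  | refl =>
    obtain ⟨u, hu⟩ := hP
    refine Relation.ReflTransGen.single ⟨{v}, ?_, rfl⟩
    have hmem : {u} ∈ (K.link v).faces := by rw [← hM, hu]; rfl
    obtain ⟨_, h2, h3⟩ := hmem
    refine ⟨face_subset h3 (by simp) (by simp), _, ⟨h3, ?_⟩, ?_⟩
    · rw [Finset.ssubset_iff_subset_ne]
      refine ⟨by simp, fun h => ?_⟩
      have : u ∈ ({v} : Finset V) := by rw [h]; simp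
      simp only [Finset.mem_singleton] at this h2
      exact h2 this.symm
    · rintro ρ ⟨hρ, hvρ⟩
      obtain ⟨ρ', h1, h2, rfl⟩ := exists_link_cons hρ (by simpa using hvρ.1) hvρ (by simp)
      rw [← hM, hu] at h2
      cases h2
      rfl
  | head h _ ih =>
    obtain ⟨σ, hfree, rfl⟩ := h
    subst hM
    have hv : v ∉ σ := hfree.1.2.1
    have := ih (K.deletion (σ.cons v hv)) (link_deletion_cons hv).symm
    rw [deletion_cons_deletion] at this
    exact this.head ⟨_, hfree.cons_of_link hv, rfl⟩

theorem NonEvasive.collapsible (h : K.NonEvasive) : K.Collapsible := by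
  induction h with
  | point K hK => exact ⟨K, .refl, hK⟩
  | step K v _ _ _ ihl ihd =>
    obtain ⟨P, h1, h2⟩ := ihl
    obtain ⟨Q, h3, h4⟩ := ihd
    exact ⟨Q, (collapses_to_deletion h1 h2 K rfl).trans h3, h4⟩

/-! ### Combinatorial connectedness and first cohomology -/

/-- The full subcomplex on the vertices in `U`. -/
def restrict (K : PreAbstractSimplicialComplex V) (U : Set V) :
    PreAbstractSimplicialComplex V where
  faces := {s | s ∈ K.faces ∧ ∀ x ∈ s, x ∈ U}
  isRelLowerSet_faces := by
    rintro s ⟨hs, hU⟩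
    exact ⟨face_nonempty hs, fun t hts ht => ⟨face_subset hs hts ht, fun x hx => hU x (hts hx)⟩⟩

/-- A set of vertices closed under adjacency that contains one vertex contains them all. -/
def IsConnected (K : PreAbstractSimplicialComplex V) : Prop :=
  ∀ C : Set V, (∀ s ∈ K.faces, ∀ x ∈ s, ∀ y ∈ s, x ∈ C → y ∈ C) →
    ∀ x ∈ C, {x} ∈ K.faces → ∀ y, {y} ∈ K.faces → y ∈ C

/-- Every integral simplicial `1`-cocycle is a coboundary. -/
def CocyclesExact (K : PreAbstractSimplicialComplex V) : Prop :=
  ∀ c : V → V → ℤ, (∀ s ∈ K.faces, ∀ x ∈ s, ∀ y ∈ s, ∀ z ∈ s, c x y + c y z = c x z) →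
    ∃ h : V → ℤ, ∀ s ∈ K.faces, ∀ x ∈ s, ∀ y ∈ s, c x y = h y - h x

/-- The `1`-skeleton is a forest: every finite set of vertices contains a vertex with at most one
neighbour in the set. -/
def IsForest (K : PreAbstractSimplicialComplex V) : Prop :=
  ∀ S : Finset V, S.Nonempty → ∃ x ∈ S, ∀ y ∈ S, ∀ z ∈ S, y ≠ x → z ≠ x →
    ∀ s ∈ K.faces, x ∈ s → y ∈ s → ∀ t ∈ K.faces, x ∈ t → z ∈ t → y = z

theorem IsForest.mono {L : PreAbstractSimplicialComplex V} (h : K.IsForest)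
    (hL : L.faces ⊆ K.faces) : L.IsForest := fun S hS => by
  obtain ⟨x, hx, h⟩ := h S hS
  exact ⟨x, hx, fun y hy z hz h1 h2 s hs hxs hys t ht hxt hzt =>
    h y hy z hz h1 h2 s (hL hs) hxs hys t (hL ht) hxt hzt⟩

theorem finite_vertices (hfin : K.faces.Finite) : {v | {v} ∈ K.faces}.Finite :=
  Set.Finite.preimage (fun _ _ _ _ h => Finset.singleton_injective h) hfin

theorem IsConnected.exists_neighbor (hconn : K.IsConnected) {x y : V} (hx : {x} ∈ K.faces)
    (hy : {y} ∈ K.faces) (hxy : y ≠ x) : ∃ s ∈ K.faces, x ∈ s ∧ ∃ z ∈ s, z ≠ x := by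
  by_contra! hno
  refine hxy (hconn {x} ?_ x rfl hx y hy)
  rintro s hs a ha b hb rfl
  exact hno s hs ha b hb

theorem isPoint_of_unique {v : V} (hv : {v} ∈ K.faces) (h : ∀ y, {y} ∈ K.faces → y = v) :
    K.IsPoint := by
  refine ⟨v, Set.eq_singleton_iff_unique_mem.2 ⟨hv, fun s hs => ?_⟩⟩
  exact Finset.eq_singleton_iff_nonempty_unique_mem.2
    ⟨face_nonempty hs, fun x hx => h x (vertex_of_mem hs hx)⟩

/-- A finite connected forest is a tree. Prune a leaf: its link is its only neighbour, and the rest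
is still a tree. -/
theorem IsForest.nonEvasive (hfin : K.faces.Finite) (hne : K.faces.Nonempty)
    (hconn : K.IsConnected) (hK : K.IsForest) : K.NonEvasive := by
  classical
  induction hn : K.faces.ncard using Nat.strong_induction_on generalizing K with
  | _ n ih =>
  have hVf := finite_vertices hfin
  obtain ⟨s₀, hs₀⟩ := hne
  obtain ⟨v₀, hv₀⟩ := face_nonempty hs₀
  obtain ⟨x, hx, hxu⟩ := hK hVf.toFinset ⟨v₀, by simpa using vertex_of_mem hs₀ hv₀⟩
  simp only [Set.Finite.mem_toFinset, Set.mem_ofPred_eq] at hx hxu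
  by_cases hall : ∀ y, {y} ∈ K.faces → y = x
  · exact .point _ (isPoint_of_unique hx hall)
  push Not at hall
  obtain ⟨y, hy, hyx⟩ := hall
  obtain ⟨s, hs, hxs, z, hzs, hzx⟩ := hconn.exists_neighbor hx hy hyx
  have hnb : ∀ t ∈ K.faces, x ∈ t → ∀ y ∈ t, y ≠ x → y = z := fun t ht hxt y hyt hyx =>
    hxu y (vertex_of_mem ht hyt) z (vertex_of_mem hs hzs) hyx hzx t ht hxt hyt s hs hxs hzs
  have hzdel : {z} ∈ (K.deletion {x}).faces :=
    mem_deletion_singleton.2 ⟨vertex_of_mem hs hzs, by simpa using hzx.symm⟩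
  refine .step K x hx (.point _ ?_) ?_
  · refine isPoint_of_unique (v := z) (vertex_of_mem (erase_mem_link hs hxs hzs hzx) (by simp [hzs, hzx])) ?_
    rintro w ⟨_, h1, h2⟩
    refine hnb _ h2 (by simp) w (by simp) ?_
    rintro rfl
    simp at h1
  · refine ih _ (hn ▸ deletion_ncard_lt hfin hx) (hfin.subset deletion_faces_subset) ⟨_, hzdel⟩ ?_
      (hK.mono deletion_faces_subset) rfl
    intro C hC a haC ha b hb
    rw [mem_deletion_singleton] at ha hb
    -- The leaf x is put on the same side as its neighbour z, so that a set closed under adjacency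
    -- in K - x stays closed in K.
    have key := hconn {u | if u = x then z ∈ C else u ∈ C} ?_ a ?_ ha.1 b hb.1
    · have : b ≠ x := by rintro rfl; simp at hb
      simpa [this] using key
    · intro t ht p hp q hq
      simp only [Set.mem_ofPred_eq]
      by_cases hxt : x ∈ t
      · by_cases h1 : p = x <;> by_cases h2 : q = x <;> simp only [h1, h2, if_true, if_false, imp_self]
        · rw [hnb t ht hxt q hq h2]; exact id
        · rw [hnb t ht hxt p hp h1]; exact id
        · rw [hnb t ht hxt p hp h1, hnb t ht hxt q hq h2]; exact id
      · have h1 : p ≠ x := by rintro rfl; exact hxt hp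
        have h2 : q ≠ x := by rintro rfl; exact hxt hq
        simp only [h1, h2, if_false]
        exact hC t (mem_deletion_singleton.2 ⟨ht, hxt⟩) p hp q hq
    · have : a ≠ x := by rintro rfl; simp at ha
      simpa [this] using haC

theorem cocycle_self {c : V → V → ℤ}
    (hc : ∀ s ∈ K.faces, ∀ x ∈ s, ∀ y ∈ s, ∀ z ∈ s, c x y + c y z = c x z)
    {s : Finset V} (hs : s ∈ K.faces) {x : V} (hx : x ∈ s) : c x x = 0 := by
  have := hc s hs x hx x hx x hx
  omega

theorem cocycle_symm {c : V → V → ℤ}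
    (hc : ∀ s ∈ K.faces, ∀ x ∈ s, ∀ y ∈ s, ∀ z ∈ s, c x y + c y z = c x z)
    {s : Finset V} (hs : s ∈ K.faces) {x y : V} (hx : x ∈ s) (hy : y ∈ s) : c y x = - c x y := by
  have := hc s hs x hx y hy x hx
  have := cocycle_self hc hs hx
  omega

/-- Build the potential by adding one leaf at a time: the value at a leaf is forced by its at most
one neighbour and meets no other constraint. -/
theorem IsForest.cocyclesExact (hfin : K.faces.Finite) (hK : K.IsForest) : K.CocyclesExact := by
  classical
  intro c hc
  suffices H : ∀ n, ∀ S : Finset V, S.card = n → ∃ h : V → ℤ, ∀ s ∈ K.faces, s ⊆ S →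
      ∀ x ∈ s, ∀ y ∈ s, c x y = h y - h x by
    obtain ⟨h, hh⟩ := H _ (finite_vertices hfin).toFinset rfl
    exact ⟨h, fun s hs => hh s hs fun x hx => by simpa using vertex_of_mem hs hx⟩
  intro n
  induction n with
  | zero =>
    intro S hS
    rw [Finset.card_eq_zero] at hS
    subst hS
    exact ⟨0, fun s _ hs0 x hx => by simpa using hs0 hx⟩
  | succ n ih =>
    intro S hS
    obtain ⟨x, hx, hxu⟩ := hK S (Finset.card_pos.1 (by omega))
    obtain ⟨h, hh⟩ := ih (S.erase x) (by rw [Finset.card_erase_of_mem hx, hS]; rfl)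
    have hrest : ∀ a : ℤ, ∀ s ∈ K.faces, s ⊆ S → ∀ p ∈ s, ∀ q ∈ s, p ≠ x → q ≠ x →
        c p q = Function.update h x a q - Function.update h x a p := by
      intro a s hs hsS p hp q hq hpx hqx
      rw [Function.update_of_ne hpx, Function.update_of_ne hqx]
      exact hh (s.erase x) (face_subset hs (Finset.erase_subset _ _) ⟨p, by simp [hp, hpx]⟩)
        (Finset.erase_subset_erase _ hsS) p (by simp [hp, hpx]) q (by simp [hq, hqx])
    obtain ⟨a, ha⟩ : ∃ a, ∀ s ∈ K.faces, s ⊆ S → x ∈ s → ∀ y ∈ s, y ≠ x → a = h y - c x y := by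
      by_cases hex : ∃ s ∈ K.faces, s ⊆ S ∧ x ∈ s ∧ ∃ y ∈ s, y ≠ x
      · obtain ⟨t, ht, htS, hxt, z, hzt, hzx⟩ := hex
        refine ⟨h z - c x z, fun s hs hsS hxs y hys hyx => ?_⟩
        rw [hxu y (hsS hys) z (htS hzt) hyx hzx s hs hxs hys t ht hxt hzt]
      · push Not at hex
        exact ⟨0, fun s hs hsS hxs y hys hyx => absurd (hex s hs hsS hxs y hys) hyx⟩
    refine ⟨Function.update h x a, fun s hs hsS p hp q hq => ?_⟩
    by_cases hpx : p = x <;> by_cases hqx : q = x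
    · rw [hpx, hqx, sub_self]; exact cocycle_self hc hs (hpx ▸ hp)
    · subst hpx
      rw [Function.update_self, Function.update_of_ne hqx, ha s hs hsS hp q hq hqx]; ring
    · subst hqx
      rw [Function.update_self, Function.update_of_ne hpx, ha s hs hsS hq p hp hpx,
        cocycle_symm hc hs hq hp]
      ring
    · exact hrest a s hs hsS p hp q hq hpx hqx

/-! ### Planar acyclic complexes are non-evasive -/

/-- Mayer–Vietoris for K as the union of K - v and the star of v: a cocycle on K - v is exact on the
link, so it extends over the star as a coboundary, and the extension is exact on K. -/
theorem CocyclesExact.deletion {v : V} (hK : K.CocyclesExact)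
    (hlink : (K.link v).CocyclesExact) : (K.deletion {v}).CocyclesExact := by
  classical
  intro c hc
  have hc' : ∀ s ∈ K.faces, v ∉ s → ∀ x ∈ s, ∀ y ∈ s, ∀ z ∈ s, c x y + c y z = c x z :=
    fun s hs hv => hc s (mem_deletion_singleton.2 ⟨hs, hv⟩)
  obtain ⟨k, hk⟩ := hlink c fun s hs => hc' s (link_faces_subset hs) hs.2.1
  -- The potential on the link is extended to the apex v by an arbitrary value, here 0.
  set k' := Function.update k v 0 with hk'
  set c' : V → V → ℤ := fun x y => if x = v ∨ y = v then k' y - k' x else c x y with hc'def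
  have hstar : ∀ s ∈ K.faces, v ∈ s → ∀ x ∈ s, ∀ y ∈ s, c' x y = k' y - k' x := by
    intro s hs hvs x hx y hy
    by_cases h : x = v ∨ y = v
    · simp [hc'def, h]
    · simp only [hc'def, h, if_false]
      push Not at h
      rw [hk', Function.update_of_ne h.1, Function.update_of_ne h.2]
      exact hk _ (erase_mem_link hs hvs hx h.1) x (by simp [hx, h.1]) y (by simp [hy, h.2])
  have hoff : ∀ s ∈ K.faces, v ∉ s → ∀ x ∈ s, ∀ y ∈ s, c' x y = c x y := by
    intro s hs hvs x hx y hy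
    have h1 : x ≠ v := by rintro rfl; exact hvs hx
    have h2 : y ≠ v := by rintro rfl; exact hvs hy
    simp [hc'def, h1, h2]
  obtain ⟨h, hh⟩ := hK c' fun s hs x hx y hy z hz => by
    by_cases hvs : v ∈ s
    · rw [hstar s hs hvs x hx y hy, hstar s hs hvs y hy z hz, hstar s hs hvs x hx z hz]; ring
    · rw [hoff s hs hvs x hx y hy, hoff s hs hvs y hy z hz, hoff s hs hvs x hx z hz]
      exact hc' s hs hvs x hx y hy z hz
  refine ⟨h, fun s hs x hx y hy => ?_⟩
  rw [mem_deletion_singleton] at hs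
  rw [← hoff s hs.1 hs.2 x hx y hy]
  exact hh s hs.1 x hx y hy

/-- The connecting map of Mayer–Vietoris: a separation of the link gives a 1-cocycle on K supported
on the edges at v. A potential for it is constant on the connected complex K - v, yet must differ by
1 between the two sides of the separation. -/
theorem IsConnected.link {v : V} (hK : K.CocyclesExact)
    (hdel : (K.deletion {v}).IsConnected) : (K.link v).IsConnected := by
  classical
  intro C hC x hxC hx y hy
  by_contra hyC
  -- An edge from v has weight 1 if it ends in C and 0 otherwise. The cocycle identity holds because
  -- the part of a face lying in the link is either inside C or disjoint from it.
  set c : V → V → ℤ := fun a b => if a = v then (if b = v then 0 else if b ∈ C then 1 else 0)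
    else if b = v then - (if a ∈ C then 1 else 0) else 0 with hcdef
  obtain ⟨h, hh⟩ := hK c fun s hs a ha b hb d hd => by
    by_cases hvs : v ∈ s
    · have hiff : ∀ p ∈ s, ∀ q ∈ s, p ≠ v → q ≠ v → (p ∈ C → q ∈ C) := fun p hp q hq hpv hqv =>
        hC _ (erase_mem_link hs hvs hp hpv) p (by simp [hp, hpv]) q (by simp [hq, hqv])
      obtain ⟨e, he⟩ : ∃ e : ℤ, ∀ p ∈ s, p ≠ v → (if p ∈ C then (1 : ℤ) else 0) = e := by
        by_cases hex : ∃ p ∈ s, p ≠ v ∧ p ∈ C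
        · obtain ⟨p, hp, hpv, hpC⟩ := hex
          exact ⟨1, fun q hq hqv => if_pos (hiff p hp q hq hpv hqv hpC)⟩
        · push Not at hex
          exact ⟨0, fun q hq hqv => if_neg (hex q hq hqv)⟩
      have hc : ∀ p ∈ s, ∀ q ∈ s, c p q =
          (if q = v then 0 else e) - (if p = v then 0 else e) := by
        intro p hp q hq
        have h1 := he p hp
        have h2 := he q hq
        simp only [hcdef]
        by_cases hpv : p = v <;> by_cases hqv : q = v <;>
          simp only [hpv, hqv, if_true, if_false] <;> simp_all
      rw [hc a ha b hb, hc b hb d hd, hc a ha d hd]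
      ring
    · have h1 : ∀ p ∈ s, p ≠ v := by rintro p hp rfl; exact hvs hp
      simp [hcdef, h1 a ha, h1 b hb, h1 d hd]
  obtain ⟨_, hxv, hxs⟩ := hx
  obtain ⟨_, hyv, hys⟩ := hy
  have hxv' : x ≠ v := by rintro rfl; simp at hxv
  have hyv' : y ≠ v := by rintro rfl; simp at hyv
  have e1 := hh _ hxs v (by simp) x (by simp)
  have e2 := hh _ hys v (by simp) y (by simp)
  simp only [hcdef, if_true, hxv', hyv', if_false, hxC, hyC] at e1 e2
  have e3 : h y = h x := by
    refine hdel {u | h u = h x} ?_ x rfl ?_ y ?_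
    · intro s hs a ha b hb hab
      rw [mem_deletion_singleton] at hs
      have h1 : ∀ p ∈ s, p ≠ v := by rintro p hp rfl; exact hs.2 hp
      have := hh s hs.1 a ha b hb
      simp only [hcdef, h1 a ha, h1 b hb, if_false] at this
      simp only [Set.mem_ofPred_eq] at hab ⊢
      omega
    · exact mem_deletion_singleton.2 ⟨vertex_of_mem hxs (by simp), by simpa using hxv'.symm⟩
    · exact mem_deletion_singleton.2 ⟨vertex_of_mem hys (by simp), by simpa using hyv'.symm⟩
  omega

/-- The height function `G` is injective on vertices, and at each vertex both the part of the link
below and the part above the vertex are forests. -/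
def IsPlanarHeight (K : PreAbstractSimplicialComplex V) (G : V → ℝ) : Prop :=
  Set.InjOn G {v | {v} ∈ K.faces} ∧ ∀ v, {v} ∈ K.faces →
    ((K.link v).restrict {u | G u < G v}).IsForest ∧ ((K.link v).restrict {u | G v < G u}).IsForest

theorem IsPlanarHeight.deletion {G : V → ℝ} (h : K.IsPlanarHeight G) (σ : Finset V) :
    (K.deletion σ).IsPlanarHeight G := by
  refine ⟨h.1.mono fun v hv => hv.1, fun v hv => ?_⟩
  have hsub : ((K.deletion σ).link v).faces ⊆ (K.link v).faces := by
    rintro s ⟨h1, h2, h3⟩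
    exact ⟨h1, h2, h3.1⟩
  exact ⟨(h.2 v hv.1).1.mono fun s hs => ⟨hsub hs.1, hs.2⟩,
    (h.2 v hv.1).2.mono fun s hs => ⟨hsub hs.1, hs.2⟩⟩

/-- Neighbours of a vertex of C lie in C or equal w. If w is below the top vertex of C, that vertex
has all its neighbours below it. Otherwise w is at least as high as all of C, and the bottom vertex
has all its neighbours above it. Either way the whole link is a half link. -/
theorem IsPlanarHeight.exists_extreme {G : V → ℝ} (h : K.IsPlanarHeight G) {C : Finset V} {w : V}
    (hw : {w} ∈ K.faces) (hC : ∀ x ∈ C, {x} ∈ K.faces ∧ x ≠ w) (hne : C.Nonempty)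
    (hcl : ∀ s ∈ K.faces, w ∉ s → ∀ x ∈ s, ∀ y ∈ s, x ∈ C → y ∈ C) :
    ∃ v ∈ C, (K.link v).IsForest := by
  classical
  have hnb : ∀ v ∈ C, ∀ s ∈ (K.link v).faces, ∀ y ∈ s, y ≠ v ∧ {y} ∈ K.faces ∧ (y = w ∨ y ∈ C) := by
    intro v hv s hs y hy
    refine ⟨by rintro rfl; exact hs.2.1 hy, vertex_of_mem (link_faces_subset hs) hy, ?_⟩
    by_cases hyw : y = w
    · exact .inl hyw
    obtain ⟨_, h1, h2⟩ := hs
    refine .inr (hcl {v, y} (face_subset h2 ?_ (by simp)) ?_ v (by simp) y (by simp) hv)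
    · intro a ha
      simp only [Finset.mem_insert, Finset.mem_singleton] at ha
      rcases ha with rfl | rfl <;> simp [hy]
    · simp [(hC v hv).2.symm, Ne.symm hyw]
  obtain ⟨v, hv, hmax⟩ := C.exists_max_image G hne
  obtain ⟨u, hu, hmin⟩ := C.exists_min_image G hne
  by_cases hwv : G w < G v
  · refine ⟨v, hv, (h.2 v (hC v hv).1).1.mono fun s hs => ⟨hs, fun y hy => ?_⟩⟩
    obtain ⟨h1, h2, h3⟩ := hnb v hv s hs y hy
    rcases h3 with rfl | h3
    · exact hwv
    · exact lt_of_le_of_ne (hmax y h3) fun e => h1 (h.1 h2 (hC v hv).1 e)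
  · refine ⟨u, hu, (h.2 u (hC u hu).1).2.mono fun s hs => ⟨hs, fun y hy => ?_⟩⟩
    obtain ⟨h1, h2, h3⟩ := hnb u hu s hs y hy
    have hle : G u ≤ G y := by
      rcases h3 with rfl | h3
      · exact (hmin v hv).trans (not_lt.1 hwv)
      · exact hmin y h3
    exact lt_of_le_of_ne hle fun e => h1 (h.1 h2 (hC u hu).1 e.symm)

/-- C is a union of components of K - w. If its extreme vertex v is a cut vertex of K, a piece of K
- v that misses w lies inside C without v. Repeat with that smaller piece, v taking the place of w,
until a vertex that is not a cut vertex is found. -/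
theorem IsPlanarHeight.exists_removable {G : V → ℝ} (h : K.IsPlanarHeight G)
    (hconn : K.IsConnected) (C : Finset V) {w : V} (hw : {w} ∈ K.faces)
    (hC : ∀ x ∈ C, {x} ∈ K.faces ∧ x ≠ w) (hne : C.Nonempty)
    (hcl : ∀ s ∈ K.faces, w ∉ s → ∀ x ∈ s, ∀ y ∈ s, x ∈ C → y ∈ C) :
    ∃ v, {v} ∈ K.faces ∧ (K.link v).IsForest ∧ (K.deletion {v}).IsConnected := by
  classical
  induction hn : C.card using Nat.strong_induction_on generalizing C w with
  | _ n ih =>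
  obtain ⟨v, hv, hforest⟩ := h.exists_extreme hw hC hne hcl
  by_cases hdel : (K.deletion {v}).IsConnected
  · exact ⟨v, (hC v hv).1, hforest, hdel⟩
  obtain ⟨D, hDcl, x, hxD, hx, hxv, hwD⟩ : ∃ D : Set V, (∀ s ∈ K.faces, v ∉ s → ∀ x ∈ s, ∀ y ∈ s,
      x ∈ D → y ∈ D) ∧ ∃ x ∈ D, {x} ∈ K.faces ∧ x ≠ v ∧ w ∉ D := by
    unfold IsConnected at hdel
    push Not at hdel
    obtain ⟨D, hD, x, hxD, hx, y, hy, hyD⟩ := hdel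
    rw [mem_deletion_singleton] at hx hy
    have hD' : ∀ s ∈ K.faces, v ∉ s → ∀ x ∈ s, ∀ y ∈ s, x ∈ D → y ∈ D :=
      fun s hs hvs => hD s (mem_deletion_singleton.2 ⟨hs, hvs⟩)
    -- Both D and its complement are closed under adjacency away from v; keep the one that misses w.
    by_cases hwD : w ∈ D
    · exact ⟨Dᶜ, fun s hs hvs a ha b hb haD hbD => haD (hD' s hs hvs b hb a ha hbD), y, hyD, hy.1,
        by rintro rfl; simp at hy, fun h => h hwD⟩
    · exact ⟨D, hD', x, hxD, hx.1, by rintro rfl; simp at hx, hwD⟩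
  have hvw := (hC v hv).2
  have hpair : ∀ s ∈ K.faces, ∀ a ∈ s, ∀ b ∈ s, ({a, b} : Finset V) ∈ K.faces := by
    intro s hs a ha b hb
    refine face_subset hs ?_ (by simp)
    intro c hc
    simp only [Finset.mem_insert, Finset.mem_singleton] at hc
    rcases hc with rfl | rfl <;> assumption
  -- The vertices of D outside C and different from v are adjacent neither to v, which lies in C,
  -- nor to w, which is not in D. They would be cut off from v in the connected complex K.
  have hDC : ∀ y ∈ D, {y} ∈ K.faces → y ≠ v → y ∈ C := by
    by_contra! hcon
    obtain ⟨y, hyD, hy, hyv, hyC⟩ := hcon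
    have := hconn {u | u ∈ D ∧ u ∉ C ∧ u ≠ v} ?_ y ⟨hyD, hyC, hyv⟩ hy v (hC v hv).1
    · exact this.2.2 rfl
    · rintro s hs a ha b hb ⟨h1, h2, h3⟩
      have haw : a ≠ w := by rintro rfl; exact hwD h1
      have hbv : b ≠ v := by
        rintro rfl
        exact h2 (hcl _ (hpair s hs a ha b hb) (by simp [haw.symm, hvw.symm]) b (by simp) a (by simp) hv)
      have hbD : b ∈ D :=
        hDcl _ (hpair s hs a ha b hb) (by simp [h3.symm, hbv.symm]) a (by simp) b (by simp) h1
      have hbw : b ≠ w := by rintro rfl; exact hwD hbD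
      exact ⟨hbD, fun hbC => h2 (hcl _ (hpair s hs a ha b hb) (by simp [haw.symm, hbw.symm])
        b (by simp) a (by simp) hbC), hbv⟩
  have hsub : (C.erase v).filter (· ∈ D) ⊆ C.erase v := Finset.filter_subset _ _
  refine ih _ ?_ ((C.erase v).filter (· ∈ D)) (hC v hv).1 ?_ ⟨x, ?_⟩ ?_ rfl
  · rw [← hn]
    exact (Finset.card_le_card hsub).trans_lt (Finset.card_erase_lt_of_mem hv)
  · intro y hy
    simp only [Finset.mem_filter, Finset.mem_erase] at hy
    exact ⟨(hC y hy.1.2).1, hy.1.1⟩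
  · simp [hxv, hxD, hDC x hxD hx hxv]
  · intro s hs hvs a ha b hb haD
    simp only [Finset.mem_filter, Finset.mem_erase] at haD ⊢
    have hbv : b ≠ v := by rintro rfl; exact hvs hb
    have hbD := hDcl s hs hvs a ha b hb haD.2
    exact ⟨⟨hbv, hDC b hbD (vertex_of_mem hs hb) hbv⟩, hbD⟩

/-- A removable vertex has a forest link, which is connected by `IsConnected.link` and hence a tree.
Trees have exact cocycles, so all the hypotheses pass to the deletion. -/
theorem IsPlanarHeight.nonEvasive {G : V → ℝ} (hfin : K.faces.Finite) (hne : K.faces.Nonempty)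
    (hconn : K.IsConnected) (hcoh : K.CocyclesExact) (hG : K.IsPlanarHeight G) :
    K.NonEvasive := by
  classical
  induction hn : K.faces.ncard using Nat.strong_induction_on generalizing K with
  | _ n ih =>
  obtain ⟨s₀, hs₀⟩ := hne
  obtain ⟨w, hw⟩ := face_nonempty hs₀
  replace hw := vertex_of_mem hs₀ hw
  by_cases hall : ∀ y, {y} ∈ K.faces → y = w
  · exact .point _ (isPoint_of_unique hw hall)
  push Not at hall
  obtain ⟨y, hy, hyw⟩ := hall
  obtain ⟨v, hv, hforest, hdel⟩ := hG.exists_removable hconn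
    ((finite_vertices hfin).toFinset.erase w) hw (fun x hx => by simpa [and_comm] using hx)
    ⟨y, by simp [hy, hyw]⟩ (fun s hs hws a _ b hb _ => by
      simp only [Finset.mem_erase, Set.Finite.mem_toFinset, Set.mem_ofPred_eq]
      exact ⟨by rintro rfl; exact hws hb, vertex_of_mem hs hb⟩)
  obtain ⟨u, hu, huv⟩ : ∃ u, {u} ∈ K.faces ∧ u ≠ v := by
    by_cases h : w = v
    · exact ⟨y, hy, h ▸ hyw⟩
    · exact ⟨w, hw, h⟩
  obtain ⟨s, hs, hvs, z, hzs, hzv⟩ := hconn.exists_neighbor hv hu huv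
  have hlf : (K.link v).faces.Finite := hfin.subset link_faces_subset
  refine .step K v hv (hforest.nonEvasive hlf ⟨_, erase_mem_link hs hvs hzs hzv⟩
    (IsConnected.link hcoh hdel)) ?_
  exact ih _ (hn ▸ deletion_ncard_lt hfin hv) (hfin.subset deletion_faces_subset)
    ⟨{u}, mem_deletion_singleton.2 ⟨hu, by simpa using huv.symm⟩⟩ hdel
    (hcoh.deletion (hforest.cocyclesExact hlf)) (hG.deletion _) rfl

end PreAbstractSimplicialComplex

/-! ### Local-to-global principle on compact convex sets -/

section LocalToGlobal

variable {E : Type*} [NormedAddCommGroup E] [NormedSpace ℝ E]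

/-- A property of compact convex subsets of `A` that holds locally and can be glued along
hyperplanes holds for `A`. -/
theorem IsCompact.convex_induction [FiniteDimensional ℝ E] {A : Set E} (hA : IsCompact A)
    (hconv : Convex ℝ A) (hne : A.Nonempty) (good : Set E → Prop)
    (glue : ∀ A' ⊆ A, Convex ℝ A' → ∀ (l : E →L[ℝ] ℝ) (c : ℝ),
      good (A' ∩ {x | l x ≤ c}) → good (A' ∩ {x | c ≤ l x}) → good A')
    (loc : ∀ p ∈ A, ∃ U ∈ 𝓝 p, ∀ A' ⊆ A, A' ⊆ U → Convex ℝ A' → good A') : good A := by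
  have hloc' : ∀ p : E, ∃ U ∈ 𝓝 p, p ∈ A → ∀ A' ⊆ A, A' ⊆ U → Convex ℝ A' → good A' := by
    intro p
    by_cases hp : p ∈ A
    · obtain ⟨U, h1, h2⟩ := loc p hp
      exact ⟨U, h1, fun _ => h2⟩
    · exact ⟨Set.univ, Filter.univ_mem, fun h => absurd h hp⟩
  choose U hU hgood using hloc'
  obtain ⟨δ, hδ, hleb⟩ := lebesgue_number_lemma_of_metric (c := fun p : A => interior (U p)) hA
    (fun _ => isOpen_interior) fun p hp => Set.mem_iUnion.2 ⟨⟨p, hp⟩, mem_interior_iff_mem_nhds.2 (hU p)⟩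
  set n := Module.finrank ℝ E
  let e : E ≃L[ℝ] (Fin n → ℝ) := (Module.finBasis ℝ E).equivFunL
  obtain ⟨ε, hε, hdist⟩ : ∃ ε > 0, ∀ x y : E, (∀ i, |e x i - e y i| ≤ ε) → dist x y < δ := by
    obtain ⟨η, hη, h⟩ := Metric.uniformContinuous_iff.1
      (e.symm : (Fin n → ℝ) →L[ℝ] E).uniformContinuous δ hδ
    refine ⟨η / 2, by positivity, fun x y hxy => ?_⟩
    have : dist (e x) (e y) < η :=
      ((dist_pi_le_iff (by positivity)).2 fun i => by
        rw [Real.dist_eq]; exact hxy i).trans_lt (half_lt_self hη)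
    have h2 := h this
    rwa [ContinuousLinearEquiv.coe_coe, e.symm_apply_apply, e.symm_apply_apply] at h2
  -- Induction on the number k of coordinates in which the set may be wide. With k = 0 the set is
  -- smaller than the Lebesgue number δ and the local hypothesis applies. Otherwise cut coordinate k
  -- into slabs of width ε and glue them one at a time.
  have main : ∀ k ≤ n, ∀ A' ⊆ A, Convex ℝ A' →
      (∀ i : Fin n, k ≤ i → ∀ x ∈ A', ∀ y ∈ A', |e x i - e y i| ≤ ε) → good A' := by
    intro k
    induction k with
    | zero =>
      intro _ A' hA' hc hw
      rcases A'.eq_empty_or_nonempty with rfl | ⟨x, hx⟩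
      · obtain ⟨p, hp⟩ := hne
        exact hgood p hp _ (Set.empty_subset _) (Set.empty_subset _) hc
      obtain ⟨p, hp⟩ := hleb x (hA' hx)
      refine hgood p p.2 A' hA' (fun y hy => interior_subset (hp ?_)) hc
      exact Metric.mem_ball.2 (hdist y x fun i => hw i (Nat.zero_le _) y hy x hx)
    | succ k ih =>
      intro hk A' hA' hc hw
      let l : E →L[ℝ] ℝ := (ContinuousLinearMap.proj (⟨k, hk⟩ : Fin n)).comp (e : E →L[ℝ] (Fin n → ℝ))
      have hl : ∀ x, l x = e x ⟨k, hk⟩ := fun x => rfl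
      have slab : ∀ N : ℕ, ∀ a : ℝ, ∀ B ⊆ A', Convex ℝ B → (∀ x ∈ B, a ≤ l x ∧ l x ≤ a + N * ε) →
          good B := by
        intro N
        have base : ∀ a : ℝ, ∀ B ⊆ A', Convex ℝ B → (∀ x ∈ B, a ≤ l x ∧ l x ≤ a + ε) → good B := by
          intro a B hB hBc hBl
          refine ih (by omega) B (hB.trans hA') hBc fun i hi x hx y hy => ?_
          rcases Nat.eq_or_lt_of_le hi with h | h
          · have hik : i = ⟨k, hk⟩ := Fin.ext h.symm
            subst hik
            have h1 := hBl x hx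
            have h2 := hBl y hy
            rw [hl] at h1 h2
            rw [abs_le]
            constructor <;> linarith
          · exact hw i h x (hB hx) y (hB hy)
        induction N with
        | zero =>
          intro a B hB hBc hBl
          refine base a B hB hBc fun x hx => ⟨(hBl x hx).1, ?_⟩
          have := (hBl x hx).2
          simp only [Nat.cast_zero, zero_mul] at this
          linarith
        | succ N ihN =>
          intro a B hB hBc hBl
          refine glue B (hB.trans hA') hBc l (a + N * ε) ?_ ?_
          · exact ihN a _ (Set.inter_subset_left.trans hB)
              (hBc.inter (convex_halfSpace_le l.isLinear _))
              fun x hx => ⟨(hBl x hx.1).1, hx.2⟩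
          · refine base (a + N * ε) _ (Set.inter_subset_left.trans hB)
              (hBc.inter (convex_halfSpace_ge l.isLinear _)) fun x hx => ⟨hx.2, ?_⟩
            have := (hBl x hx.1).2
            push_cast at this
            linarith
      obtain ⟨M, hM⟩ := (hA.image l.continuous).isBounded.exists_norm_le
      obtain ⟨N, hN⟩ := exists_nat_ge (2 * M / ε)
      rw [div_le_iff₀ hε] at hN
      refine slab N (-M) A' subset_rfl hc fun x hx => ?_
      have := abs_le.1 (hM (l x) ⟨x, hA' hx, rfl⟩)
      constructor <;> linarith
  exact main n le_rfl A subset_rfl hconv fun i hi => absurd i.2 (by omega)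

/-- A carrier function on `A`: it grows near each point and is monotone along segments between
comparable points. -/
structure IsCarrier {V : Type*} (s : E → Finset V) (A : Set E) : Prop where
  eventually_subset : ∀ p ∈ A, ∃ U ∈ 𝓝 p, ∀ q ∈ A, q ∈ U → s p ⊆ s q
  segment : ∀ p ∈ A, ∀ q ∈ A, s p ⊆ s q → ∀ r ∈ segment ℝ p q, s p ⊆ s r ∧ s r ⊆ s q

theorem IsCarrier.mono {V : Type*} {s : E → Finset V} {A B : Set E} (h : IsCarrier s A)
    (hB : B ⊆ A) : IsCarrier s B := by
  refine ⟨fun p hp => ?_, fun p hp q hq => h.segment p (hB hp) q (hB hq)⟩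
  obtain ⟨U, hU, h⟩ := h.eventually_subset p (hB hp)
  exact ⟨U, hU, fun q hq => h q (hB hq)⟩

theorem Convex.exists_segment_eq (l : E →L[ℝ] ℝ) {c : ℝ} {p q : E} (hp : l p ≤ c) (hq : c ≤ l q) :
    ∃ r ∈ segment ℝ p q, l r = c := by
  have := (convex_segment p q (𝕜 := ℝ)).isPreconnected.image l l.continuous.continuousOn
  obtain ⟨r, hr, h⟩ := this.ordConnected.out ⟨p, left_mem_segment ℝ p q, rfl⟩
    ⟨q, right_mem_segment ℝ p q, rfl⟩ ⟨hp, hq⟩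
  exact ⟨r, hr, h⟩

variable {V : Type*} {s : E → Finset V}

/-- On a convex set, a function that is constant along the carrier order is constant. -/
theorem IsCarrier.eq_of_convex {A : Set E} (hs : IsCarrier s A)
    (hconv : Convex ℝ A) {α : Type*} (d : E → α)
    (hd : ∀ p ∈ A, ∀ q ∈ A, s p ⊆ s q → d p = d q) {p q : E} (hp : p ∈ A) (hq : q ∈ A) :
    d p = d q := by
  let _ : TopologicalSpace α := ⊥
  have : DiscreteTopology α := ⟨rfl⟩
  refine hconv.isPreconnected.constant_of_mapsTo (T := Set.univ) (f := d)
    (isDiscrete_iff_discreteTopology.2 inferInstance) ?_ (Set.mapsTo_univ _ _) hp hq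
  intro p hp
  obtain ⟨U, hU, h⟩ := hs.eventually_subset p hp
  refine tendsto_nhds_of_eventually_eq ?_ |>.mono_right le_rfl
  filter_upwards [mem_nhdsWithin_of_mem_nhds hU, self_mem_nhdsWithin] with q hq hqA
  exact (hd p hp q hqA (h q hqA hq)).symm

/-- A cocycle on the carriers of a compact convex set has a compatible family of potentials. -/
theorem IsCarrier.exists_potential [FiniteDimensional ℝ E] {A : Set E} (hs : IsCarrier s A)
    (hA : IsCompact A) (hconv : Convex ℝ A) (hne : A.Nonempty) (W : Set V)
    (hW : ∀ p ∈ A, ∃ x ∈ s p, x ∈ W) (c : V → V → ℤ)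
    (hc : ∀ p ∈ A, ∀ x ∈ s p, ∀ y ∈ s p, ∀ z ∈ s p, x ∈ W → y ∈ W → z ∈ W →
      c x y + c y z = c x z) :
    ∃ σ : E → V → ℤ, ∀ p ∈ A, (∀ x ∈ s p, ∀ y ∈ s p, x ∈ W → y ∈ W → c x y = σ p y - σ p x) ∧
      ∀ q ∈ A, s p ⊆ s q → ∀ x ∈ s p, x ∈ W → σ p x = σ q x := by
  refine hA.convex_induction hconv hne (fun A' => ∃ σ : E → V → ℤ, ∀ p ∈ A',
    (∀ x ∈ s p, ∀ y ∈ s p, x ∈ W → y ∈ W → c x y = σ p y - σ p x) ∧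
      ∀ q ∈ A', s p ⊆ s q → ∀ x ∈ s p, x ∈ W → σ p x = σ q x) ?_ ?_
  · rintro A' hA' hc' l t ⟨σ₁, h₁⟩ ⟨σ₂, h₂⟩
    obtain ⟨k, hk⟩ : ∃ k, ∀ p ∈ A', l p = t → ∀ x ∈ s p, x ∈ W → σ₁ p x = σ₂ p x + k := by
      by_cases hex : ∃ p ∈ A', l p = t
      · obtain ⟨p₀, hp₀, hlp₀⟩ := hex
        have : Nonempty V := ⟨(hW p₀ (hA' hp₀)).choose⟩
        choose! u hu huW using hW
        have hu' : ∀ p ∈ A', l p = t → ∀ x ∈ s p, x ∈ W →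
            σ₁ p x - σ₂ p x = σ₁ p (u p) - σ₂ p (u p) := by
          intro p hp hlp x hx hxW
          have e1 := (h₁ p ⟨hp, hlp.le⟩).1 x hx (u p) (hu p (hA' hp)) hxW (huW p (hA' hp))
          have e2 := (h₂ p ⟨hp, hlp.ge⟩).1 x hx (u p) (hu p (hA' hp)) hxW (huW p (hA' hp))
          omega
        refine ⟨σ₁ p₀ (u p₀) - σ₂ p₀ (u p₀), fun p hp hlp x hx hxW => ?_⟩
        have := (hs.mono (Set.inter_subset_left.trans hA') :
          IsCarrier s (A' ∩ {x | l x = t})).eq_of_convex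
          (hc'.inter (convex_hyperplane l.isLinear t))
          (fun p => σ₁ p (u p) - σ₂ p (u p)) ?_ ⟨hp, hlp⟩ ⟨hp₀, hlp₀⟩
        · have e := hu' p hp hlp x hx hxW
          omega
        · rintro p ⟨hp, hlp⟩ q ⟨hq, hlq⟩ hpq
          have e := hu' q hq hlq (u p) (hpq (hu p (hA' hp))) (huW p (hA' hp))
          have e1 := (h₁ p ⟨hp, hlp.le⟩).2 q ⟨hq, hlq.le⟩ hpq (u p) (hu p (hA' hp)) (huW p (hA' hp))
          have e2 := (h₂ p ⟨hp, hlp.ge⟩).2 q ⟨hq, hlq.ge⟩ hpq (u p) (hu p (hA' hp)) (huW p (hA' hp))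
          omega
      · push Not at hex
        exact ⟨0, fun p hp hlp => absurd hlp (hex p hp)⟩
    classical
    set σ : E → V → ℤ := fun p x => if l p ≤ t then σ₁ p x else σ₂ p x + k with hσ
    have e1 : ∀ p, l p ≤ t → ∀ x, σ p x = σ₁ p x := fun p hp x => by simp [hσ, hp]
    have e2 : ∀ p ∈ A', t ≤ l p → ∀ x ∈ s p, x ∈ W → σ p x = σ₂ p x + k := by
      intro p hp hlp x hx hxW
      by_cases h : l p ≤ t
      · rw [e1 p h, hk p hp (le_antisymm h hlp) x hx hxW]
      · simp [hσ, h]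
    have c1 : ∀ p ∈ A', ∀ q ∈ A', l p ≤ t → l q ≤ t → s p ⊆ s q → ∀ x ∈ s p, x ∈ W →
        σ p x = σ q x := by
      intro p hp q hq hlp hlq hpq x hx hxW
      rw [e1 p hlp, e1 q hlq]
      exact (h₁ p ⟨hp, hlp⟩).2 q ⟨hq, hlq⟩ hpq x hx hxW
    have c2 : ∀ p ∈ A', ∀ q ∈ A', t ≤ l p → t ≤ l q → s p ⊆ s q → ∀ x ∈ s p, x ∈ W →
        σ p x = σ q x := by
      intro p hp q hq hlp hlq hpq x hx hxW
      rw [e2 p hp hlp x hx hxW, e2 q hq hlq x (hpq hx) hxW,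
        (h₂ p ⟨hp, hlp⟩).2 q ⟨hq, hlq⟩ hpq x hx hxW]
    refine ⟨σ, fun p hp => ⟨fun x hx y hy hxW hyW => ?_, fun q hq hpq x hx hxW => ?_⟩⟩
    · rcases le_total (l p) t with h | h
      · rw [e1 p h, e1 p h]
        exact (h₁ p ⟨hp, h⟩).1 x hx y hy hxW hyW
      · rw [e2 p hp h x hx hxW, e2 p hp h y hy hyW, (h₂ p ⟨hp, h⟩).1 x hx y hy hxW hyW]
        ring
    · rcases le_total (l p) t with h | h <;> rcases le_total (l q) t with h' | h'
      · exact c1 p hp q hq h h' hpq x hx hxW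
      -- Points on opposite sides are compared through the point where their segment meets the
      -- hyperplane; its carrier lies between theirs.
      · obtain ⟨r, hr, hlr⟩ := Convex.exists_segment_eq l h h'
        obtain ⟨g1, g2⟩ := hs.segment p (hA' hp) q (hA' hq) hpq r hr
        have hrA := hc'.segment_subset hp hq hr
        rw [c1 p hp r hrA h hlr.le g1 x hx hxW, c2 r hrA q hq hlr.ge h' g2 x (g1 hx) hxW]
      · obtain ⟨r, hr, hlr⟩ := Convex.exists_segment_eq l h' h
        obtain ⟨g1, g2⟩ := hs.segment p (hA' hp) q (hA' hq) hpq r (segment_symm ℝ q p ▸ hr)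
        have hrA := hc'.segment_subset hq hp hr
        rw [c2 p hp r hrA h hlr.ge g1 x hx hxW, c1 r hrA q hq hlr.le h' g2 x (g1 hx) hxW]
      · exact c2 p hp q hq h h' hpq x hx hxW
  · intro p hp
    obtain ⟨U, hU, h⟩ := hs.eventually_subset p hp
    obtain ⟨u, hu, huW⟩ := hW p hp
    refine ⟨U, hU, fun A' hA' hAU _ => ⟨fun _ x => c u x, fun q hq => ⟨fun x hx y hy hxW hyW => ?_,
      fun _ _ _ _ _ _ => rfl⟩⟩⟩
    have := hc q (hA' hq) u (h q (hA' hq) (hAU hq) hu) x hx y hy huW hxW hyW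
    simp only
    omega

end LocalToGlobal

namespace PreAbstractSimplicialComplex

variable {V : Type*} {T : PreAbstractSimplicialComplex V}

/-! ### Simplicial fans -/

/-- Nonnegative weights on the vertices supported on a face (or zero). -/
def IsConicWeight (T : PreAbstractSimplicialComplex V) (α : V →₀ ℝ) : Prop :=
  (∀ u, 0 ≤ α u) ∧ (α.support.Nonempty → α.support ∈ T.faces)

theorem IsConicWeight.of_subset {α : V →₀ ℝ} (h0 : ∀ u, 0 ≤ α u) {t : Finset V} (ht : t ∈ T.faces)
    (h : α.support ⊆ t) : T.IsConicWeight α :=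
  ⟨h0, face_subset ht h⟩

variable {E : Type*} [NormedAddCommGroup E] [NormedSpace ℝ E]

/-- The cones spanned by the vectors `a u`, `u ∈ s`, for faces `s` of `T`, form a simplicial fan. -/
def IsFan (T : PreAbstractSimplicialComplex V) (a : V → E) : Prop :=
  Set.InjOn (Finsupp.linearCombination ℝ a) {α | T.IsConicWeight α}

/-- The support of a fan: the union of all its cones. -/
def fanSupport (T : PreAbstractSimplicialComplex V) (a : V → E) : Set E :=
  Finsupp.linearCombination ℝ a '' {α | T.IsConicWeight α}

/-- The rays of the smallest cone containing a point of the support of a fan. -/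
noncomputable def fanCarrier (T : PreAbstractSimplicialComplex V) (a : V → E) (p : E) : Finset V :=
  (Function.invFunOn (Finsupp.linearCombination ℝ a) {α | T.IsConicWeight α} p).support

variable {a : V → E}

theorem IsFan.fanCarrier_eq (hT : T.IsFan a) {α : V →₀ ℝ} (hα : T.IsConicWeight α) :
    T.fanCarrier a (Finsupp.linearCombination ℝ a α) = α.support := by
  rw [fanCarrier, hT.leftInvOn_invFunOn hα]

/-- The positive and negative parts of a linear relation on s are conic weights with the same image,
hence equal. -/
theorem IsFan.linearIndepOn (hT : T.IsFan a) {s : Finset V} (hs : s.Nonempty → s ∈ T.faces) :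
    LinearIndepOn ℝ a (s : Set V) := by
  rw [linearIndepOn_iff]
  intro l hl h0
  rw [Finsupp.mem_supported, Finset.coe_subset] at hl
  have hcon : ∀ (g : ℝ → ℝ) (hg : g 0 = 0), (∀ x, 0 ≤ g x) → T.IsConicWeight (l.mapRange g hg) := by
    intro g hg hpos
    refine ⟨fun u => by simpa using hpos _, fun hne => ?_⟩
    have hsub : (l.mapRange g hg).support ⊆ s := Finsupp.support_mapRange.trans hl
    exact face_subset (hs (hne.mono hsub)) hsub hne
  have hdec : l = l.mapRange (fun x => max x 0) (by simp) - l.mapRange (fun x => max (-x) 0) (by simp) := by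
    ext u
    simp only [Finsupp.sub_apply, Finsupp.mapRange_apply]
    rcases le_total (l u) 0 with h | h
    · rw [max_eq_right h, max_eq_left (by linarith)]; ring
    · rw [max_eq_left h, max_eq_right (by linarith)]; ring
  rw [hdec, map_sub, sub_eq_zero] at h0
  rw [hdec, sub_eq_zero]
  exact hT (hcon _ _ fun x => le_max_right _ _) (hcon _ _ fun x => le_max_right _ _) h0

theorem IsFan.isClosed_cone (hT : T.IsFan a) {s : Finset V} (hs : s.Nonempty → s ∈ T.faces) :
    IsClosed (Finsupp.linearCombination ℝ a '' {α | (∀ u, 0 ≤ α u) ∧ α.support ⊆ s}) := by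
  classical
  have hli : LinearIndependent ℝ (fun u : s => a u) := hT.linearIndepOn hs
  let Φ : (s → ℝ) →ₗ[ℝ] E := Fintype.linearCombination ℝ (fun u : s => a u)
  have hemb : Topology.IsClosedEmbedding Φ := by
    refine LinearMap.isClosedEmbedding_of_injective ?_
    rw [LinearMap.ker_eq_bot]
    exact linearIndependent_iff_injective_fintypeLinearCombination.1 hli
  convert! hemb.isClosedMap _ (isClosed_Ici (a := (0 : s → ℝ)))
  ext p
  have key : ∀ α : V →₀ ℝ, α.support ⊆ s →
      Finsupp.linearCombination ℝ a α = Φ fun u => α u := by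
    intro α hα
    rw [Finsupp.linearCombination_apply, Finsupp.sum_of_support_subset _ hα _ (by simp)]
    rw [Fintype.linearCombination_apply, ← Finset.sum_coe_sort]
  constructor
  · rintro ⟨α, ⟨h0, hα⟩, rfl⟩
    exact ⟨fun u => α u, fun u => h0 u, (key α hα).symm⟩
  · rintro ⟨x, hx, rfl⟩
    have hsub : (Finsupp.onFinset s (fun u => if h : u ∈ s then x ⟨u, h⟩ else 0)
      (fun u hu => by by_contra h; simp [h] at hu)).support ⊆ s := Finsupp.support_onFinset_subset
    refine ⟨_, ⟨fun u => ?_, hsub⟩, ?_⟩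
    · rw [Finsupp.onFinset_apply]
      split_ifs with h
      · exact hx ⟨u, h⟩
      · exact le_rfl
    · rw [key _ hsub]
      congr 1
      ext u
      simp

/-- The points whose carrier does not contain that of p lie in finitely many closed cones that miss
p. Along a segment the weights are interpolated linearly, so the supports stay between those of the
endpoints. -/
theorem IsFan.isCarrier (hfin : T.faces.Finite) (hT : T.IsFan a) {A : Set E}
    (hA : A ⊆ T.fanSupport a) : IsCarrier (T.fanCarrier a) A := by
  classical
  constructor
  · intro p hp
    obtain ⟨α, hα, rfl⟩ := hA hp
    rw [hT.fanCarrier_eq hα]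
    -- The empty set is included because it is the carrier of the origin, although it is not a face.
    set bad : Set (Finset V) := {t | t ∈ insert ∅ T.faces ∧ ¬ α.support ⊆ t} with hbad
    have hbf : bad.Finite := (hfin.insert ∅).subset fun t ht => ht.1
    have hne : ∀ t ∈ bad, t.Nonempty → t ∈ T.faces := by
      rintro t ⟨rfl | ht, _⟩ hne
      · simp at hne
      · exact ht
    have hcl : IsClosed (⋃ t ∈ bad,
        Finsupp.linearCombination ℝ a '' {α | (∀ u, 0 ≤ α u) ∧ α.support ⊆ t}) :=
      hbf.isClosed_biUnion fun t ht => hT.isClosed_cone (hne t ht)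
    refine ⟨_, hcl.isOpen_compl.mem_nhds ?_, ?_⟩
    · simp only [Set.mem_compl_iff, Set.mem_iUnion, not_exists]
      rintro t ht ⟨β, ⟨hβ0, hβt⟩, hβ⟩
      have hβc : T.IsConicWeight β :=
        ⟨hβ0, fun h => face_subset (hne t ht (h.mono hβt)) hβt h⟩
      rw [hT hβc hα hβ] at hβt
      exact ht.2 hβt
    · intro q hq hqU
      obtain ⟨β, hβ, rfl⟩ := hA hq
      rw [hT.fanCarrier_eq hβ]
      by_contra hcon
      refine hqU ?_
      simp only [Set.mem_iUnion]
      refine ⟨β.support, ⟨?_, hcon⟩, β, ⟨hβ.1, subset_rfl⟩, rfl⟩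
      rcases β.support.eq_empty_or_nonempty with h | h
      · exact .inl h
      · exact .inr (hβ.2 h)
  · intro p hp q hq hpq r hr
    obtain ⟨α, hα, rfl⟩ := hA hp
    obtain ⟨β, hβ, rfl⟩ := hA hq
    obtain ⟨x, y, hx, hy, hxy, rfl⟩ := hr
    rw [hT.fanCarrier_eq hα, hT.fanCarrier_eq hβ] at *
    have hsub : (x • α + y • β).support ⊆ β.support := by
      refine Finsupp.support_add.trans (Finset.union_subset ?_ Finsupp.support_smul)
      exact Finsupp.support_smul.trans hpq
    have hpos : ∀ u, 0 ≤ (x • α + y • β) u := fun u => by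
      have := hα.1 u
      have := hβ.1 u
      simp only [Finsupp.add_apply, Finsupp.smul_apply, smul_eq_mul]
      positivity
    have hc : T.IsConicWeight (x • α + y • β) :=
      ⟨hpos, fun h => face_subset (hβ.2 (h.mono hsub)) hsub h⟩
    rw [← map_smul, ← map_smul, ← map_add, hT.fanCarrier_eq hc]
    refine ⟨fun u hu => ?_, hsub⟩
    have h1 : 0 < α u := lt_of_le_of_ne (hα.1 u) (Ne.symm (Finsupp.mem_support_iff.1 hu))
    have h2 : 0 < β u := lt_of_le_of_ne (hβ.1 u) (Ne.symm (Finsupp.mem_support_iff.1 (hpq hu)))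
    rw [Finsupp.mem_support_iff]
    simp only [Finsupp.add_apply, Finsupp.smul_apply, smul_eq_mul]
    rcases hx.eq_or_lt with rfl | hx
    · have : y = 1 := by linarith
      subst this
      simp [h2.ne']
    · positivity

/-! ### The lower part of a fan -/

theorem isConicWeight_single {u : V} (hu : {u} ∈ T.faces) {r : ℝ} (hr : 0 ≤ r) :
    T.IsConicWeight (Finsupp.single u r) := by
  classical
  refine .of_subset (fun v => ?_) hu Finsupp.support_single_subset
  rw [Finsupp.single_apply]
  split_ifs <;> simp [hr]

theorem IsFan.fanCarrier_vertex (hT : T.IsFan a) {u : V} (hu : {u} ∈ T.faces) :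
    T.fanCarrier a (a u) = {u} := by
  have := hT.fanCarrier_eq (isConicWeight_single hu zero_le_one)
  rwa [Finsupp.linearCombination_single, one_smul, Finsupp.support_single _ one_ne_zero]
    at this

/-- The subcomplex of the vertices on which `f` is negative. -/
abbrev lowerPart (T : PreAbstractSimplicialComplex V) (a : V → E) (f : Module.Dual ℝ E) :
    PreAbstractSimplicialComplex V :=
  T.restrict {u | f (a u) < 0}

/-- The convex hull of the rays on which `f` is negative. -/
def lowerHull (T : PreAbstractSimplicialComplex V) (a : V → E) (f : Module.Dual ℝ E) : Set E :=
  convexHull ℝ (a '' {u | {u} ∈ (T.lowerPart a f).faces})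

variable {f : Module.Dual ℝ E}

theorem vertex_mem_lowerPart {u : V} :
    {u} ∈ (T.lowerPart a f).faces ↔ {u} ∈ T.faces ∧ f (a u) < 0 := by
  simp [lowerPart, restrict]

theorem exists_lower_of_neg {p : E} (hp : p ∈ T.fanSupport a) (hT : T.IsFan a) (hf : f p < 0) :
    ∃ u ∈ T.fanCarrier a p, {u} ∈ T.faces ∧ f (a u) < 0 := by
  obtain ⟨α, hα, rfl⟩ := hp
  rw [hT.fanCarrier_eq hα]
  by_contra! hcon
  refine hf.not_ge ?_
  rw [Finsupp.linearCombination_apply, Finsupp.sum, map_sum]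
  refine Finset.sum_nonneg fun u hu => ?_
  rw [map_smul, smul_eq_mul]
  exact mul_nonneg (hα.1 u) (hcon u hu (vertex_of_mem (hα.2 ⟨u, hu⟩) hu))

theorem lowerHull_neg {p : E} (hp : p ∈ T.lowerHull a f) : f p < 0 := by
  refine convexHull_min ?_ (convex_halfSpace_lt f.isLinear 0) hp
  rintro _ ⟨u, hu, rfl⟩
  exact (vertex_mem_lowerPart.1 hu).2

theorem mem_lowerHull {u : V} (hu : {u} ∈ (T.lowerPart a f).faces) : a u ∈ T.lowerHull a f :=
  subset_convexHull ℝ _ ⟨u, hu, rfl⟩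

theorem lowerCarrier_mem (hT : T.IsFan a) {p : E} (hp : p ∈ T.fanSupport a)
    {x : V} (hx : x ∈ T.fanCarrier a p) (hfx : f (a x) < 0) :
    (T.fanCarrier a p).filter (fun u => f (a u) < 0) ∈ (T.lowerPart a f).faces := by
  obtain ⟨α, hα, rfl⟩ := hp
  rw [hT.fanCarrier_eq hα] at *
  exact ⟨face_subset (hα.2 ⟨x, hx⟩) (Finset.filter_subset _ _) ⟨x, by simpa using ⟨by simpa using hx, hfx⟩⟩,
    fun u hu => (Finset.mem_filter.1 hu).2⟩

/-- On the lower hull f is negative, so every carrier contains a lower vertex, and the lower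
vertices of one carrier form a face. Hence whether a carrier meets C in a lower vertex does not
change along the carrier order, and it is constant on the hull. -/
theorem IsFan.lowerPart_isConnected (hfin : T.faces.Finite) (hT : T.IsFan a)
    (hsub : T.lowerHull a f ⊆ T.fanSupport a) : (T.lowerPart a f).IsConnected := by
  intro C hC x hxC hx y hy
  have hcar := hT.isCarrier hfin hsub
  have := hcar.eq_of_convex (convex_convexHull ℝ _)
    (fun p => ∃ u ∈ T.fanCarrier a p, f (a u) < 0 ∧ u ∈ C) ?_ (mem_lowerHull hx) (mem_lowerHull hy)
  · simp only [hT.fanCarrier_vertex hx.1, hT.fanCarrier_vertex hy.1, Finset.mem_singleton,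
      exists_eq_left, eq_iff_iff] at this
    exact (this.1 ⟨(vertex_mem_lowerPart.1 hx).2, hxC⟩).2
  · intro p hp q hq hpq
    rw [eq_iff_iff]
    constructor
    · rintro ⟨u, hu, h⟩
      exact ⟨u, hpq hu, h⟩
    · rintro ⟨u, hu, hfu, huC⟩
      obtain ⟨w, hw, -, hfw⟩ := exists_lower_of_neg (hsub hp) hT (lowerHull_neg hp)
      exact ⟨w, hw, hfw, hC _ (lowerCarrier_mem hT (hsub hq) hu hfu) u (by simp [hu, hfu]) w
        (by simp [hpq hw, hfw]) huC⟩

/-- The potentials supplied by `IsCarrier.exists_potential` are evaluated at the rays themselves. -/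
theorem IsFan.lowerPart_cocyclesExact [FiniteDimensional ℝ E] (hfin : T.faces.Finite)
    (hT : T.IsFan a) (hsub : T.lowerHull a f ⊆ T.fanSupport a)
    (hne : (T.lowerPart a f).faces.Nonempty) : (T.lowerPart a f).CocyclesExact := by
  classical
  intro c hc
  have hcar := hT.isCarrier hfin hsub
  have hcompact : IsCompact (T.lowerHull a f) :=
    ((finite_vertices (K := T.lowerPart a f)
      (hfin.subset fun s hs => hs.1)).image a).isCompact_convexHull (𝕜 := ℝ)
  obtain ⟨s₀, hs₀⟩ := hne
  obtain ⟨v₀, hv₀⟩ := face_nonempty hs₀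
  obtain ⟨σ, hσ⟩ := hcar.exists_potential hcompact (convex_convexHull ℝ _)
    ⟨_, mem_lowerHull (vertex_of_mem hs₀ hv₀)⟩ {u | f (a u) < 0}
    (fun p hp => by
      obtain ⟨u, hu, -, h⟩ := exists_lower_of_neg (hsub hp) hT (lowerHull_neg hp)
      exact ⟨u, hu, h⟩) c
    (fun p hp x hx y hy z hz hxW hyW hzW => hc _ (lowerCarrier_mem hT (hsub hp) hx hxW)
      x (by simpa using ⟨hx, hxW⟩) y (by simpa using ⟨hy, hyW⟩) z (by simpa using ⟨hz, hzW⟩))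
  refine ⟨fun u => σ (a u) u, fun s hs x hx y hy => ?_⟩
  have hxv := vertex_of_mem hs hx
  have hyv := vertex_of_mem hs hy
  -- The values at the rays x and y are compared at their midpoint, which lies in the hull and whose
  -- carrier contains both.
  set α : V →₀ ℝ := (1 / 2 : ℝ) • Finsupp.single x 1 + (1 / 2 : ℝ) • Finsupp.single y 1 with hα
  have hval : ∀ u, α u = (1 / 2) * (if x = u then 1 else 0) + (1 / 2) * (if y = u then 1 else 0) :=
    fun u => by simp [hα, Finsupp.single_apply]
  have hαc : T.IsConicWeight α := by
    refine .of_subset (fun u => ?_) hs.1 fun u hu => ?_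
    · rw [hval]; split_ifs <;> norm_num
    · rw [Finsupp.mem_support_iff, hval] at hu
      by_cases h1 : x = u
      · exact h1 ▸ hx
      · by_cases h2 : y = u
        · exact h2 ▸ hy
        · simp [h1, h2] at hu
  have hxs : x ∈ α.support := by
    rw [Finsupp.mem_support_iff, hval, if_pos rfl]; split_ifs <;> norm_num
  have hys : y ∈ α.support := by
    rw [Finsupp.mem_support_iff, hval, if_pos rfl]; split_ifs <;> norm_num
  have hp : Finsupp.linearCombination ℝ a α ∈ T.lowerHull a f := by
    have : Finsupp.linearCombination ℝ a α = (1 / 2 : ℝ) • a x + (1 / 2 : ℝ) • a y := by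
      simp [hα]
    rw [this]
    exact convex_convexHull ℝ _ (mem_lowerHull hxv) (mem_lowerHull hyv) (by norm_num) (by norm_num)
      (by norm_num)
  have hcα := hT.fanCarrier_eq hαc
  have hvert : ∀ u, {u} ∈ (T.lowerPart a f).faces → u ∈ α.support →
      σ (a u) u = σ (Finsupp.linearCombination ℝ a α) u := fun u hu hus => by
    refine (hσ (a u) (mem_lowerHull hu)).2 _ hp ?_ u ?_ (vertex_mem_lowerPart.1 hu).2
    · rw [hT.fanCarrier_vertex hu.1, hcα]
      simpa using hus
    · rw [hT.fanCarrier_vertex hu.1]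
      simp
  simp only
  rw [hvert x hxv hxs, hvert y hyv hys]
  exact (hσ _ hp).1 x (hcα ▸ hxs) y (hcα ▸ hys) (hs.2 x hx) (hs.2 y hy)

/-! ### Three-dimensional fans -/

/-- The pair (l, m) serves as coordinates on the plane E / ℝw, in which the link of a ray w is
drawn. -/
theorem exists_complementary_functional (h3 : Module.finrank ℝ E = 3) {l : Module.Dual ℝ E}
    (hl : l ≠ 0) {w : E} (hw : w ≠ 0) (hlw : l w = 0) :
    ∃ m : Module.Dual ℝ E, m w = 0 ∧ ∀ z, l z = 0 → m z = 0 → ∃ k : ℝ, z = k • w := by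
  have : FiniteDimensional ℝ E := Module.finite_of_finrank_pos (by omega)
  have h2 : Module.finrank ℝ (LinearMap.ker l) = 2 := by
    have := Module.Dual.finrank_ker_add_one_of_ne_zero hl
    omega
  set w' : LinearMap.ker l := ⟨w, hlw⟩
  have hw' : w' ≠ 0 := fun h => hw (congrArg Subtype.val h)
  have hlt : Submodule.span ℝ {w'} < ⊤ := by
    refine lt_top_iff_ne_top.2 fun h => ?_
    have h1 := finrank_span_singleton (K := ℝ) hw'
    rw [h, finrank_top, h2] at h1
    norm_num at h1
  obtain ⟨m₀, hm₀, hle⟩ := Submodule.exists_le_ker_of_lt_top _ hlt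
  have h1 : Module.finrank ℝ (LinearMap.ker m₀) = 1 := by
    have := Module.Dual.finrank_ker_add_one_of_ne_zero hm₀
    omega
  have hmw : m₀ w' = 0 := hle (Submodule.mem_span_singleton_self w')
  obtain ⟨m, hm⟩ := LinearMap.exists_extend m₀
  have hmv : ∀ z (hz : l z = 0), m z = m₀ ⟨z, hz⟩ := fun z hz => by rw [← hm]; rfl
  refine ⟨m, (hmv w hlw).trans hmw, fun z hz hmz => ?_⟩
  rw [hmv z hz] at hmz
  obtain ⟨k, hk⟩ := (finrank_eq_one_iff_of_nonzero' (⟨w', hmw⟩ : LinearMap.ker m₀)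
    (fun h => hw' (congrArg Subtype.val h))).1 h1 ⟨⟨z, hz⟩, hmz⟩
  exact ⟨k, (congrArg (fun t : LinearMap.ker m₀ => ((t : LinearMap.ker l) : E)) hk).symm⟩

/-- In an open half-plane the slope m / l orders vectors by angle, and the middle one of three lies
in the cone of the outer two. -/
theorem exists_nonneg_combination {lx ly lz mx my mz : ℝ} (hx : lx < 0) (hy : ly < 0) (hz : lz < 0)
    (hxy : mx / lx ≤ my / ly) (hyz : my / ly ≤ mz / lz) :
    ∃ α β : ℝ, 0 ≤ α ∧ 0 ≤ β ∧ ly = α * lx + β * lz ∧ my = α * mx + β * mz := by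
  obtain ⟨p, hp⟩ : ∃ p, p = mx / lx := ⟨_, rfl⟩
  obtain ⟨q, hq⟩ : ∃ q, q = my / ly := ⟨_, rfl⟩
  obtain ⟨r, hr⟩ : ∃ r, r = mz / lz := ⟨_, rfl⟩
  rw [← hp, ← hq] at hxy
  rw [← hq, ← hr] at hyz
  rw [eq_div_iff hx.ne] at hp
  rw [eq_div_iff hy.ne] at hq
  rw [eq_div_iff hz.ne] at hr
  subst hp hq hr
  have hx' := hx.ne
  have hz' := hz.ne
  rcases hyz.eq_or_lt with rfl | hlt
  · exact ⟨0, ly / lz, le_rfl, (div_pos_of_neg_of_neg hy hz).le, by field_simp; ring_nf,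
      by field_simp; ring_nf⟩
  · have hpr : 0 < r - p := by linarith
    -- The slope q is interpolated between p and r, and the weights are then rescaled to the first
    -- coordinate of the middle vector.
    refine ⟨(r - q) / (r - p) * (ly / lx), (q - p) / (r - p) * (ly / lz), ?_, ?_, ?_, ?_⟩
    · exact mul_nonneg (div_nonneg (by linarith) hpr.le) (div_pos_of_neg_of_neg hy hx).le
    · exact mul_nonneg (div_nonneg (by linarith) hpr.le) (div_pos_of_neg_of_neg hy hz).le
    · field_simp
      ring
    · field_simp
      ring

theorem IsFan.ne_zero (hT : T.IsFan a) {u : V} (hu : {u} ∈ T.faces) : a u ≠ 0 := by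
  intro h
  have := hT (isConicWeight_single hu zero_le_one) (isConicWeight_single hu le_rfl)
    (by simp [h])
  simp at this

/-- Modulo w, the ray y would lie in the cone of x and z. Adding a large enough multiple of w to
both sides gives one point with two conic weights, only one of which involves y. -/
theorem IsFan.not_overlap (hT : T.IsFan a) {w x y z : V} {s t : Finset V} (hs : s ∈ T.faces)
    (ht : t ∈ T.faces) (hws : w ∈ s) (hys : y ∈ s) (hwt : w ∈ t) (hxt : x ∈ t) (hzt : z ∈ t)
    (hyx : y ≠ x) (hyz : y ≠ z) (hyw : y ≠ w) {α β k : ℝ} (hα : 0 ≤ α) (hβ : 0 ≤ β)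
    (h : a y - (α • a x + β • a z) = k • a w) : False := by
  classical
  -- The sign of k is unknown; the coefficients |k| and |k| + k are both nonnegative and differ by
  -- k.
  have key := hT (x₁ := Finsupp.single y 1 + Finsupp.single w |k|)
    (x₂ := Finsupp.single x α + Finsupp.single z β + Finsupp.single w (|k| + k)) ?_ ?_ ?_
  · have := DFunLike.congr_fun key y
    simp [hyx.symm, hyz.symm, hyw.symm] at this
  · refine .of_subset (fun u => ?_) hs ?_
    · simp only [Finsupp.add_apply, Finsupp.single_apply]
      have := abs_nonneg k
      split_ifs <;> linarith
    · refine Finsupp.support_add.trans (Finset.union_subset ?_ ?_) <;>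
      refine Finsupp.support_single_subset.trans (by simpa)
  · refine .of_subset (fun u => ?_) ht ?_
    · simp only [Finsupp.add_apply, Finsupp.single_apply]
      have := neg_abs_le k
      split_ifs <;> linarith
    · refine Finsupp.support_add.trans (Finset.union_subset
        (Finsupp.support_add.trans (Finset.union_subset ?_ ?_)) ?_) <;>
      refine Finsupp.support_single_subset.trans (by simpa)
  · simp only [map_add, Finsupp.linearCombination_single, one_smul]
    rw [sub_eq_iff_eq_add] at h
    rw [h, add_smul]
    abel

/-- Modulo w, the link of w is a planar fan, and its rays in an open half-plane are ordered by
angle. The first ray x of any finite set has at most one neighbour there: of two neighbours, the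
nearer one would lie in the cone spanned by x and the farther one, against `IsFan.not_overlap`. -/
theorem IsFan.halfLink_isForest (h3 : Module.finrank ℝ E = 3) (hT : T.IsFan a) {w : V}
    (hw : {w} ∈ T.faces) {l : Module.Dual ℝ E} (hlw : l (a w) = 0) :
    ((T.link w).restrict {u | l (a u) < 0}).IsForest := by
  classical
  intro S hS
  by_cases hS' : ((S.filter fun u => l (a u) < 0)).Nonempty
  swap
  · obtain ⟨x, hx⟩ := hS
    refine ⟨x, hx, fun y hy z hz hyx hzx s hs hxs => ?_⟩
    exact absurd ⟨x, Finset.mem_filter.2 ⟨hx, hs.2 x hxs⟩⟩ hS'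
  have hl : l ≠ 0 := by
    rintro rfl
    simp at hS'
  obtain ⟨m, hmw, hm⟩ := exists_complementary_functional h3 hl (hT.ne_zero hw) hlw
  obtain ⟨x, hx, hmin⟩ := Finset.exists_min_image _ (fun u => m (a u) / l (a u)) hS'
  rw [Finset.mem_filter] at hx
  have main : ∀ y ∈ S, ∀ z ∈ S, y ≠ x → z ≠ x →
      ∀ s ∈ ((T.link w).restrict {u | l (a u) < 0}).faces, x ∈ s → y ∈ s →
      ∀ t ∈ ((T.link w).restrict {u | l (a u) < 0}).faces, x ∈ t → z ∈ t →
      m (a y) / l (a y) ≤ m (a z) / l (a z) → y = z := by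
    intro y hy z hz hyx hzx s hs hxs hys t ht hxt hzt hle
    by_contra hyz
    obtain ⟨⟨-, hws, hs⟩, hsl⟩ := hs
    obtain ⟨⟨-, hwt, ht⟩, htl⟩ := ht
    obtain ⟨α, β, hα, hβ, e1, e2⟩ := exists_nonneg_combination hx.2 (hsl y hys) (htl z hzt)
      (hmin y (Finset.mem_filter.2 ⟨hy, hsl y hys⟩)) hle
    obtain ⟨k, hk⟩ := hm (a y - (α • a x + β • a z)) (by simp [← e1]) (by simp [← e2])
    exact hT.not_overlap hs ht (by simp) (by simp [hys]) (by simp) (by simp [hxt]) (by simp [hzt])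
      hyx hyz (by rintro rfl; exact hws hys) hα hβ hk
  refine ⟨x, hx.1, fun y hy z hz hyx hzx s hs hxs hys t ht hxt hzt => ?_⟩
  rcases le_total (m (a y) / l (a y)) (m (a z) / l (a z)) with h | h
  · exact main y hy z hz hyx hzx s hs hxs hys t ht hxt hzt h
  · exact (main z hz y hy hzx hyx t ht hxt hzt s hs hxs hys h).symm

/-- The height is a generic linear functional g read off after central projection to the plane f =
-1, that is, g / (-f). Comparing the heights of u and v is then a sign condition at u for a linear
functional vanishing at v, so the upper and lower links are half links. -/
theorem IsFan.lowerPart_exists_height (h3 : Module.finrank ℝ E = 3) (hfin : T.faces.Finite)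
    (hT : T.IsFan a) : ∃ G, (T.lowerPart a f).IsPlanarHeight G := by
  classical
  have hVf : {u | {u} ∈ (T.lowerPart a f).faces}.Finite :=
    finite_vertices (hfin.subset fun s hs => hs.1)
  set I := {p : V × V | {p.1} ∈ (T.lowerPart a f).faces ∧ {p.2} ∈ (T.lowerPart a f).faces ∧
    p.1 ≠ p.2}
  have hI : Finite I := (hVf.prod hVf).subset fun p hp => ⟨hp.1, hp.2.1⟩
  -- Two heights agree exactly when g kills f(u) v - f(v) u. These finitely many vectors are nonzero
  -- because distinct rays of a fan are not positively proportional.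
  obtain ⟨g, hg⟩ := Module.exists_dual_forall_apply_ne_zero (K := ℝ)
    (fun p : I => f (a p.1.1) • a p.1.2 - f (a p.1.2) • a p.1.1) (by
      rintro ⟨⟨u, v⟩, hu, hv, huv⟩ h
      simp only at h hu hv huv
      rw [vertex_mem_lowerPart] at hu hv
      have := hT (isConicWeight_single hv.1 (neg_pos.2 hu.2).le)
        (isConicWeight_single hu.1 (neg_pos.2 hv.2).le) (by
          simp only [Finsupp.linearCombination_single, neg_smul]
          rw [sub_eq_zero.1 h])
      have := DFunLike.congr_fun this v
      rw [Finsupp.single_eq_same, Finsupp.single_eq_of_ne huv.symm] at this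
      linarith)
  have hcmp : ∀ u v, f (a u) < 0 → f (a v) < 0 →
      (g (a u) / -f (a u) < g (a v) / -f (a v) ↔ (-f (a v)) * g (a u) + g (a v) * f (a u) < 0) := by
    intro u v hu hv
    rw [div_lt_div_iff₀ (neg_pos.2 hu) (neg_pos.2 hv)]
    constructor <;> intro h <;> linarith
  have hlink : ∀ v (U : Set V), ∀ s ∈ (((T.lowerPart a f).link v).restrict U).faces,
      s ∈ (T.link v).faces ∧ ∀ u ∈ s, f (a u) < 0 := by
    rintro v U s ⟨⟨h1, h2, h3⟩, -⟩
    exact ⟨⟨h1, h2, h3.1⟩, fun u hu => h3.2 u (by simp [hu])⟩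
  refine ⟨fun u => g (a u) / -f (a u), ?_, fun v hv => ⟨?_, ?_⟩⟩
  · intro u hu v hv huv
    by_contra hne
    refine hg ⟨(u, v), hu, hv, hne⟩ ?_
    have h1 := (vertex_mem_lowerPart.1 hu).2
    have h2 := (vertex_mem_lowerPart.1 hv).2
    simp only at huv
    rw [div_eq_div_iff (neg_pos.2 h1).ne' (neg_pos.2 h2).ne'] at huv
    simp only [map_sub, map_smul, smul_eq_mul]
    linarith
  · obtain ⟨hv1, hv2⟩ := vertex_mem_lowerPart.1 hv
    refine (hT.halfLink_isForest h3 hv1 (l := (-f (a v)) • g + g (a v) • f) ?_).mono fun s hs => ?_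
    · simp; ring
    · obtain ⟨h1, h2⟩ := hlink v _ s hs
      exact ⟨h1, fun u hu => by simpa using (hcmp u v (h2 u hu) hv2).1 (hs.2 u hu)⟩
  · obtain ⟨hv1, hv2⟩ := vertex_mem_lowerPart.1 hv
    refine (hT.halfLink_isForest h3 hv1 (l := f (a v) • g - g (a v) • f) ?_).mono fun s hs => ?_
    · simp; ring
    · obtain ⟨h1, h2⟩ := hlink v _ s hs
      refine ⟨h1, fun u hu => ?_⟩
      have := (hcmp v u hv2 (h2 u hu)).1 (hs.2 u hu)
      simp only [Set.mem_ofPred_eq, LinearMap.sub_apply, LinearMap.smul_apply, smul_eq_mul]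
      linarith

/-- In a three-dimensional fan whose support contains the convex hull of its lower rays, the
lower part is non-evasive. -/
theorem IsFan.lowerPart_nonEvasive (h3 : Module.finrank ℝ E = 3) (hfin : T.faces.Finite)
    (hT : T.IsFan a) (hsub : T.lowerHull a f ⊆ T.fanSupport a)
    (hne : (T.lowerPart a f).faces.Nonempty) : (T.lowerPart a f).NonEvasive := by
  have : FiniteDimensional ℝ E := Module.finite_of_finrank_pos (by omega)
  obtain ⟨G, hG⟩ := hT.lowerPart_exists_height (f := f) h3 hfin
  exact hG.nonEvasive (hfin.subset fun s hs => hs.1) hne (hT.lowerPart_isConnected hfin hsub)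
    (hT.lowerPart_cocyclesExact hfin hsub hne)

end PreAbstractSimplicialComplex

namespace PreAbstractSimplicialComplex

variable {V E : Type*} [NormedAddCommGroup E] [NormedSpace ℝ E]

/-! ### Geometric simplicial complexes as fans at height one -/

theorem _root_.AffineIndependent.weights_unique {s : Finset E}
    (hs : AffineIndependent ℝ ((↑) : s → E)) {w w' : E → ℝ} (h1 : ∑ e ∈ s, w e = ∑ e ∈ s, w' e)
    (h2 : ∑ e ∈ s, w e • e = ∑ e ∈ s, w' e • e) : ∀ e ∈ s, w e = w' e := by
  intro e he
  have := affineIndependent_iff.1 hs Finset.univ (fun i => w i - w' i)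
    (by rw [Finset.sum_coe_sort s (fun i => w i - w' i), Finset.sum_sub_distrib, h1, sub_self])
    (by rw [Finset.sum_coe_sort s (fun i => (w i - w' i) • i)]
        simp only [sub_smul, Finset.sum_sub_distrib, h2, sub_self])
    ⟨e, he⟩ (Finset.mem_univ _)
  simpa [sub_eq_zero] using this

theorem linearCombination_height (φ : V → E) (α : V →₀ ℝ) {s : Finset V} (hs : α.support ⊆ s) :
    Finsupp.linearCombination ℝ (fun u => (φ u, (1 : ℝ))) α =
      (∑ u ∈ s, α u • φ u, ∑ u ∈ s, α u) := by
  rw [Finsupp.linearCombination_apply, Finsupp.sum_of_support_subset _ hs _ (by simp)]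
  ext <;> simp [Prod.fst_sum, Prod.snd_sum]

/-- The last coordinate records the total weight. After dividing by it, the two weights describe one
point of two simplices, hence a point of their common face, and barycentric coordinates in each
simplex are unique. -/
theorem _root_.Geometry.SimplicialComplex.isFan (L : Geometry.SimplicialComplex ℝ E) :
    L.toPreAbstractSimplicialComplex.IsFan (fun e : E => (e, (1 : ℝ))) := by
  classical
  intro α hα β hβ h
  replace h := (linearCombination_height id α subset_rfl).symm.trans
    (h.trans (linearCombination_height id β subset_rfl))
  obtain ⟨h1, h2⟩ := Prod.ext_iff.1 h
  simp only [id] at h1 h2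
  have hzero : ∀ γ : E →₀ ℝ, (∀ u, 0 ≤ γ u) → ∑ u ∈ γ.support, γ u = 0 → γ = 0 := by
    intro γ hγ h0
    rw [Finset.sum_eq_zero_iff_of_nonneg fun u _ => hγ u] at h0
    ext u
    by_contra hu
    exact hu (h0 u (Finsupp.mem_support_iff.2 hu))
  set M := ∑ u ∈ α.support, α u with hM
  have hM0 : 0 ≤ M := Finset.sum_nonneg fun u _ => hα.1 u
  rcases hM0.eq_or_lt with h0 | hMpos
  · rw [hzero α hα.1 h0.symm, hzero β hβ.1 (by rw [← h2, h0])]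
  have hmem : ∀ γ : E →₀ ℝ, (∀ u, 0 ≤ γ u) → ∑ u ∈ γ.support, γ u = M →
      M⁻¹ • ∑ u ∈ γ.support, γ u • u ∈ convexHull ℝ (γ.support : Set E) := by
    intro γ hγ hsum
    rw [Finset.smul_sum]
    simp only [smul_smul]
    refine (convex_convexHull ℝ _).sum_mem (fun u _ => mul_nonneg (by positivity) (hγ u)) ?_
      fun u hu => subset_convexHull ℝ _ hu
    rw [← Finset.mul_sum, hsum, inv_mul_cancel₀ hMpos.ne']
  have hface : ∀ γ : E →₀ ℝ, L.toPreAbstractSimplicialComplex.IsConicWeight γ →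
      ∑ u ∈ γ.support, γ u = M → γ.support ∈ L.faces := by
    intro γ hγ hsum
    refine hγ.2 (Finset.nonempty_iff_ne_empty.2 fun he => ?_)
    rw [he, Finset.sum_empty] at hsum
    exact hMpos.ne hsum
  have hxs := hmem α hα.1 rfl
  have hxt := hmem β hβ.1 h2.symm
  rw [← h1] at hxt
  have hx := L.inter_subset_convexHull (hface α hα rfl) (hface β hβ h2.symm) ⟨hxs, hxt⟩
  rw [← Finset.coe_inter, Finset.mem_convexHull'] at hx
  obtain ⟨w, -, hw1, hwx⟩ := hx
  -- Barycentric coordinates on the common face, scaled back to total weight M; both α and β are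
  -- shown to equal these.
  set w' : E → ℝ := fun e => if e ∈ α.support ∩ β.support then M * w e else 0 with hw'
  have huniq : ∀ γ : E →₀ ℝ, γ.support ∈ L.faces → α.support ∩ β.support ⊆ γ.support →
      ∑ u ∈ γ.support, γ u = M → ∑ u ∈ γ.support, γ u • u = ∑ u ∈ α.support, α u • u →
      ∀ e, γ e = w' e := by
    intro γ hγ hsub hs1 hs2 e
    by_cases he : e ∈ γ.support
    · refine (L.indep hγ).weights_unique ?_ ?_ e he
      · rw [hs1, hw', ← Finset.sum_filter, Finset.filter_mem_eq_inter,
          Finset.inter_eq_right.2 hsub, ← Finset.mul_sum, hw1, mul_one]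
      · simp only [hw', ite_smul, zero_smul]
        rw [hs2, ← Finset.sum_filter, Finset.filter_mem_eq_inter,
          Finset.inter_eq_right.2 hsub]
        simp only [mul_smul]
        rw [← Finset.smul_sum, hwx, smul_inv_smul₀ hMpos.ne']
    · rw [Finsupp.notMem_support_iff.1 he, hw']
      simp only
      rw [if_neg fun h => he (hsub h)]
  ext e
  rw [huniq α (hface α hα rfl) Finset.inter_subset_left rfl rfl e,
    huniq β (hface β hβ h2.symm) Finset.inter_subset_right h2.symm h1.symm e]

variable {B : PreAbstractSimplicialComplex V} {φ : V → E} {L : Geometry.SimplicialComplex ℝ E}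

theorem IsLinearEmbedding.isFan (h : B.IsLinearEmbedding φ L) :
    B.IsFan (fun u => (φ u, (1 : ℝ))) := by
  classical
  intro α hα β hβ hαβ
  have hmap : ∀ γ : V →₀ ℝ, B.IsConicWeight γ →
      L.toPreAbstractSimplicialComplex.IsConicWeight (γ.mapDomain φ) := by
    intro γ hγ
    refine ⟨fun e => ?_, fun hne => ?_⟩
    · exact Finsupp.mapDomain_nonneg (g := γ) hγ.1 e
    · have hsub : (γ.mapDomain φ).support ⊆ γ.support.image φ := Finsupp.mapDomain_support
      have hs := hγ.2 (Finset.image_nonempty.1 (hne.mono hsub))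
      exact face_subset ((h.2 (γ.support.image φ)).2 ⟨_, hs, by simp⟩) hsub hne
  have hcomp : ∀ γ : V →₀ ℝ, Finsupp.linearCombination ℝ (fun e : E => (e, (1 : ℝ)))
      (γ.mapDomain φ) = Finsupp.linearCombination ℝ (fun u => (φ u, (1 : ℝ))) γ := fun γ =>
    Finsupp.linearCombination_mapDomain ℝ _ _
  have hinj := L.isFan (hmap α hα) (hmap β hβ) (by rw [hcomp, hcomp]; exact hαβ)
  have hvert : ∀ γ : V →₀ ℝ, B.IsConicWeight γ → (γ.support : Set V) ⊆ {v | {v} ∈ B.faces} :=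
    fun γ hγ u hu => vertex_of_mem (hγ.2 ⟨u, hu⟩) hu
  exact Finsupp.mapDomain_injOn _ h.1 (hvert α hα) (hvert β hβ) hinj

theorem IsLinearEmbedding.space_subset (h : B.IsLinearEmbedding φ L) {p : E} (hp : p ∈ L.space) :
    (p, (1 : ℝ)) ∈ B.fanSupport (fun u => (φ u, (1 : ℝ))) := by
  classical
  obtain ⟨t, ht, hpt⟩ := Geometry.SimplicialComplex.mem_space_iff.1 hp
  obtain ⟨s, hs, hst⟩ := (h.2 t).1 ht
  rw [hst] at hpt
  suffices H : p ∈ {q : E | ∃ α : V →₀ ℝ, ((∀ u, 0 ≤ α u) ∧ α.support ⊆ s) ∧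
      Finsupp.linearCombination ℝ (fun u => (φ u, (1 : ℝ))) α = (q, 1)} by
    obtain ⟨α, ⟨h0, hα⟩, hq⟩ := H
    exact ⟨α, .of_subset h0 hs hα, hq⟩
  refine convexHull_min ?_ ?_ hpt
  · rintro _ ⟨u, hu, rfl⟩
    refine ⟨Finsupp.single u 1, ⟨fun v => ?_, Finsupp.support_single_subset.trans (by simpa using hu)⟩,
      by simp⟩
    rw [Finsupp.single_apply]
    split_ifs <;> simp
  · rintro q₁ ⟨α, ⟨hα0, hα⟩, h1⟩ q₂ ⟨β, ⟨hβ0, hβ⟩, h2⟩ x y hx hy hxy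
    refine ⟨x • α + y • β, ⟨fun u => ?_, ?_⟩, ?_⟩
    · have := hα0 u
      have := hβ0 u
      simp only [Finsupp.add_apply, Finsupp.smul_apply, smul_eq_mul]
      positivity
    · exact Finsupp.support_add.trans (Finset.union_subset (Finsupp.support_smul.trans hα)
        (Finsupp.support_smul.trans hβ))
    · rw [map_add, map_smul, map_smul, h1, h2]
      simp [hxy]

theorem IsLinearEmbedding.vertex_mem_space (h : B.IsLinearEmbedding φ L) {u : V}
    (hu : {u} ∈ B.faces) : φ u ∈ L.space :=
  Geometry.SimplicialComplex.subset_space ((h.2 {φ u}).2 ⟨_, hu, by simp⟩) (by simp)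

/-! ### The fan of a vertex link -/

theorem linearCombination_link (φ : V → E) (v : V) (α : V →₀ ℝ) :
    Finsupp.linearCombination ℝ (fun u => φ u - φ v) α =
      (Finsupp.linearCombination ℝ (fun u => (φ u, (1 : ℝ))) α).1 -
        (Finsupp.linearCombination ℝ (fun u => (φ u, (1 : ℝ))) α).2 • φ v := by
  have := Finsupp.apply_linearCombination ℝ
    (LinearMap.fst ℝ E ℝ - (LinearMap.snd ℝ E ℝ).smulRight (φ v)) (fun u => (φ u, (1 : ℝ))) α
  simp only [LinearMap.sub_apply, LinearMap.fst_apply, LinearMap.smulRight_apply,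
    LinearMap.snd_apply] at this
  rw [this]
  congr 2
  ext u
  simp

/-- Two weights on the link with the same image agree modulo v. Adding to each, as a weight at v,
the total weight of the other equalises the heights and keeps both weights in the star of v, where
injectivity for B applies. -/
theorem IsFan.link (hB : B.IsFan (fun u => (φ u, (1 : ℝ)))) {v : V} (hv : {v} ∈ B.faces) :
    (B.link v).IsFan (fun u => φ u - φ v) := by
  classical
  have hcone : ∀ α : V →₀ ℝ, (B.link v).IsConicWeight α → α v = 0 ∧
      ∀ r : ℝ, 0 ≤ r → B.IsConicWeight (α + Finsupp.single v r) := by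
    intro α hα
    have hpos : ∀ r : ℝ, 0 ≤ r → ∀ u, 0 ≤ (α + Finsupp.single v r) u := fun r hr u => by
      have := hα.1 u
      rw [Finsupp.add_apply, Finsupp.single_apply]
      split_ifs <;> linarith
    rcases α.support.eq_empty_or_nonempty with he | hne
    · rw [Finsupp.support_eq_empty] at he
      subst he
      exact ⟨rfl, fun r hr => by rw [zero_add]; exact isConicWeight_single hv hr⟩
    · obtain ⟨-, h2, h3⟩ := hα.2 hne
      refine ⟨Finsupp.notMem_support_iff.1 h2, fun r hr => .of_subset (hpos r hr) h3 ?_⟩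
      exact Finsupp.support_add.trans (Finset.union_subset (Finset.subset_cons _)
        (Finsupp.support_single_subset.trans (by simp)))
  intro α hα β hβ h
  obtain ⟨hαv, hαc⟩ := hcone α hα
  obtain ⟨hβv, hβc⟩ := hcone β hβ
  rw [linearCombination_link, linearCombination_link] at h
  have hnn : ∀ γ : V →₀ ℝ, (∀ u, 0 ≤ γ u) →
      0 ≤ (Finsupp.linearCombination ℝ (fun u => (φ u, (1 : ℝ))) γ).2 := by
    intro γ hγ
    rw [linearCombination_height φ γ subset_rfl]
    exact Finset.sum_nonneg fun u _ => hγ u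
  have key := hB (hαc _ (hnn β hβ.1)) (hβc _ (hnn α hα.1)) (by
    simp only [map_add, Finsupp.linearCombination_single]
    ext1
    · simp only [Prod.fst_add, Prod.smul_fst]
      rw [sub_eq_sub_iff_add_eq_add] at h
      exact h
    · simp only [Prod.snd_add, Prod.smul_snd, smul_eq_mul, mul_one]
      exact add_comm _ _)
  ext u
  by_cases huv : u = v
  · rw [huv, hαv, hβv]
  · have := DFunLike.congr_fun key u
    simpa [huv, Ne.symm huv] using this

/-- Move from v a short way towards p. By convexity the point stays in the body, and near v it lies
in a simplex containing v. Dropping the weight at v and rescaling by the inverse of the step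
expresses p - φ v in the cone of a link face. -/
theorem IsLinearEmbedding.sub_mem_fanSupport_link (h : B.IsLinearEmbedding φ L)
    (hfin : B.faces.Finite) (hconv : Convex ℝ L.space) {v : V} (hv : {v} ∈ B.faces) {p : E}
    (hp : p ∈ L.space) : p - φ v ∈ (B.link v).fanSupport (fun u => φ u - φ v) := by
  classical
  have hfan := h.isFan
  have hcar := hfan.isCarrier hfin subset_rfl
  obtain ⟨U, hU, hUs⟩ := hcar.eventually_subset _ (h.space_subset (h.vertex_mem_space hv))
  have htend : Filter.Tendsto (fun ε : ℝ => (φ v + ε • (p - φ v), (1 : ℝ))) (𝓝[>] 0)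
      (𝓝 (φ v, (1 : ℝ))) := by
    have : Continuous (fun ε : ℝ => (φ v + ε • (p - φ v), (1 : ℝ))) := by fun_prop
    have := (this.tendsto 0).mono_left (nhdsWithin_le_nhds (s := Set.Ioi 0))
    simpa using this
  obtain ⟨ε, hεU, hε0, hε1⟩ :=
    ((htend.eventually hU).and (Ioc_mem_nhdsGT (zero_lt_one (α := ℝ)))).exists
  have hq : φ v + ε • (p - φ v) ∈ L.space :=
    hconv.add_smul_sub_mem (h.vertex_mem_space hv) hp ⟨hε0.le, hε1⟩
  have hq' := h.space_subset hq
  have hsub := hUs _ hq' hεU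
  obtain ⟨α, hα, hαq⟩ := hq'
  rw [← hαq, hfan.fanCarrier_eq hα, hfan.fanCarrier_vertex (a := fun u => (φ u, (1 : ℝ))) hv] at hsub
  have hvα : v ∈ α.support := hsub (by simp)
  refine ⟨ε⁻¹ • α.erase v, ⟨fun u => ?_, fun hne => ?_⟩, ?_⟩
  · rw [Finsupp.smul_apply, Finsupp.erase_apply]
    split_ifs
    · simp
    · exact mul_nonneg (by positivity) (hα.1 u)
  · have hs : (ε⁻¹ • α.erase v).support = α.support.erase v := by
      rw [Finsupp.support_smul_eq (inv_ne_zero hε0.ne'), Finsupp.support_erase]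
    rw [hs] at hne ⊢
    obtain ⟨u, hu⟩ := hne
    rw [Finset.mem_erase] at hu
    exact erase_mem_link (hα.2 ⟨v, hvα⟩) hvα hu.2 hu.1
  · have h1 : Finsupp.linearCombination ℝ (fun u => φ u - φ v) (α.erase v) =
        Finsupp.linearCombination ℝ (fun u => φ u - φ v) α := by
      conv_rhs => rw [← Finsupp.single_add_erase v α]
      simp
    rw [map_smul, h1, linearCombination_link, hαq]
    simp [smul_smul, inv_mul_cancel₀ hε0.ne']

/-! ### Sweeping a convex complex by a generic linear functional -/

/-- Translated by φ v, the lower hull is spanned by vertices of the body and so lies in it; the fan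
of the link therefore covers the hull. The lower vertex u ensures that at least one ray points down.
-/
theorem IsLinearEmbedding.link_lowerPart_nonEvasive (h3 : Module.finrank ℝ E = 3)
    (h : B.IsLinearEmbedding φ L) (hfin : B.faces.Finite) (hconv : Convex ℝ L.space)
    (f : Module.Dual ℝ E) {u v : V} (hu : {u} ∈ B.faces) (hv : {v} ∈ B.faces)
    (huv : f (φ u) < f (φ v)) :
    ((B.link v).lowerPart (fun u => φ u - φ v) f).NonEvasive := by
  have hfan := h.isFan.link hv
  refine hfan.lowerPart_nonEvasive h3 (hfin.subset link_faces_subset) ?_ ?_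
  · intro p hp
    have hp' : p ∈ (fun z => z + φ v) ⁻¹' L.space := by
      refine convexHull_min ?_ (hconv.translate_preimage_left _) hp
      rintro _ ⟨w, hw, rfl⟩
      simpa using h.vertex_mem_space (vertex_of_mem (link_faces_subset hw.1) (by simp))
    simpa using h.sub_mem_fanSupport_link hfin hconv hv hp'
  · obtain ⟨w, -, hw, hfw⟩ := exists_lower_of_neg (f := f)
      (h.sub_mem_fanSupport_link hfin hconv hv (h.vertex_mem_space hu)) hfan
      (by simpa using huv)
    exact ⟨_, vertex_mem_lowerPart.2 ⟨hw, hfw⟩⟩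

/-- The sweep: U is a sublevel set of f, and its highest vertex is removed. Stating this for every
lower set of vertices lets the induction proceed, since the partial complexes need not be convex. -/
theorem IsLinearEmbedding.restrict_nonEvasive (h3 : Module.finrank ℝ E = 3)
    (h : B.IsLinearEmbedding φ L) (hfin : B.faces.Finite) (hconv : Convex ℝ L.space)
    (f : Module.Dual ℝ E) (hf : Set.InjOn (fun u => f (φ u)) {v | {v} ∈ B.faces}) (U : Set V)
    (hU : ∀ x y, {x} ∈ B.faces → {y} ∈ B.faces → f (φ x) ≤ f (φ y) → y ∈ U → x ∈ U)
    (hne : (B.restrict U).faces.Nonempty) : (B.restrict U).NonEvasive := by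
  induction hn : (B.restrict U).faces.ncard using Nat.strong_induction_on generalizing U with
  | _ n ih =>
  have hKfin : (B.restrict U).faces.Finite := hfin.subset fun s hs => hs.1
  obtain ⟨s₀, hs₀⟩ := hne
  obtain ⟨v₀, hv₀⟩ := face_nonempty hs₀
  obtain ⟨v, hv, hmax⟩ := Finset.exists_max_image (finite_vertices hKfin).toFinset
    (fun u => f (φ u)) ⟨v₀, by simpa using vertex_of_mem hs₀ hv₀⟩
  simp only [Set.Finite.mem_toFinset, Set.mem_ofPred_eq] at hv hmax
  by_cases hall : ∀ y, {y} ∈ (B.restrict U).faces → y = v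
  · exact .point _ (isPoint_of_unique hv hall)
  push Not at hall
  obtain ⟨u, hu, huv⟩ := hall
  have hvU : v ∈ U := hv.2 v (by simp)
  have hlt : ∀ x, {x} ∈ B.faces → x ∈ U → x ≠ v → f (φ x) < f (φ v) := fun x hx hxU hxv =>
    lt_of_le_of_ne (hmax x ⟨hx, by simpa using hxU⟩) fun e => hxv (hf hx hv.1 e)
  have hlink : (B.restrict U).link v = (B.link v).lowerPart (fun u => φ u - φ v) f := by
    ext s
    constructor
    · rintro ⟨h1, h2, h3, h4⟩
      refine ⟨⟨h1, h2, h3⟩, fun x hx => ?_⟩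
      have := hlt x (vertex_of_mem h3 (by simp [hx])) (h4 x (by simp [hx]))
        (by rintro rfl; exact h2 hx)
      simpa using this
    · rintro ⟨⟨h1, h2, h3⟩, h4⟩
      refine ⟨h1, h2, h3, fun x hx => ?_⟩
      rw [Finset.mem_cons] at hx
      rcases hx with rfl | hx
      · exact hvU
      · have hx4 : f (φ x - φ v) < 0 := h4 x hx
        rw [map_sub, sub_neg] at hx4
        exact hU x v (vertex_of_mem h3 (by simp [hx])) hv.1 hx4.le hvU
  have hdel : (B.restrict U).deletion {v} = B.restrict (U \ {v}) := by
    ext s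
    rw [mem_deletion_singleton]
    constructor
    · rintro ⟨⟨h1, h2⟩, h3⟩
      exact ⟨h1, fun x hx => ⟨h2 x hx, by rintro rfl; exact h3 hx⟩⟩
    · rintro ⟨h1, h2⟩
      exact ⟨⟨h1, fun x hx => (h2 x hx).1⟩, fun hvs => (h2 v hvs).2 rfl⟩
  refine .step _ v hv ?_ ?_
  · rw [hlink]
    exact h.link_lowerPart_nonEvasive h3 hfin hconv f hu.1 hv.1
      (hlt u hu.1 (hu.2 u (by simp)) huv)
  · have hcard := deletion_ncard_lt hKfin hv
    rw [hdel] at hcard ⊢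
    refine ih _ (hn ▸ hcard) _ ?_ ⟨{u}, hu.1, ?_⟩ rfl
    · rintro x y hx hy hxy ⟨hyU, hyv⟩
      refine ⟨hU x y hx hy hxy hyU, ?_⟩
      rintro rfl
      exact (hlt y hy hyU hyv).not_ge hxy
    · intro x hx
      rw [Finset.mem_singleton] at hx
      subst hx
      exact ⟨hu.2 x (by simp), huv⟩

theorem IsLinearEmbedding.nonEvasive (h3 : Module.finrank ℝ E = 3)
    (h : B.IsLinearEmbedding φ L) (hfin : B.faces.Finite) (hne : B.faces.Nonempty)
    (hconv : Convex ℝ L.space) : B.NonEvasive := by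
  set I := {p : V × V | {p.1} ∈ B.faces ∧ {p.2} ∈ B.faces ∧ p.1 ≠ p.2}
  have hI : Finite I :=
    ((finite_vertices hfin).prod (finite_vertices hfin)).subset fun p hp => ⟨hp.1, hp.2.1⟩
  -- A generic functional is nonzero on the finitely many differences of distinct vertices, hence
  -- injective on the vertices.
  obtain ⟨f, hf⟩ := Module.exists_dual_forall_apply_ne_zero (K := ℝ)
    (fun p : I => φ p.1.1 - φ p.1.2) (by
      rintro ⟨⟨u, v⟩, hu, hv, huv⟩ h0
      exact huv (h.1 hu hv (sub_eq_zero.1 h0)))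
  have huniv : B.restrict Set.univ = B := by
    ext s
    simp [restrict]
  rw [← huniv]
  refine h.restrict_nonEvasive h3 hfin hconv f ?_ _ (fun _ _ _ _ _ _ => Set.mem_univ _)
    (by rwa [huniv])
  intro u hu v hv huv
  by_contra hne
  exact hf ⟨(u, v), hu, hv, hne⟩ (by simpa [sub_eq_zero] using huv)

end PreAbstractSimplicialComplex

/-! ### Convexly embedded 3-balls. -/

theorem corollary2p7 {V : Type*} (B : PreAbstractSimplicialComplex V)
    (hball : B.IsSimplicialBall 3) (hconvex : B.HasConvexLinearEmbedding 3) :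
    B.NonEvasive ∧ B.Collapsible := by
  obtain ⟨hfin, ⟨e⟩⟩ := hball
  obtain ⟨φ, L, hemb, hconv⟩ := hconvex
  -- The centre of the ball corresponds to a point of the realization, whose supporting face shows
  -- that B is nonempty.
  obtain ⟨-, s, hs, -⟩ := (e.symm ⟨0, by simp⟩).2
  have h := hemb.nonEvasive (by simp) hfin ⟨s, hs⟩ hconv
  exact ⟨h, h.collapsible⟩
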